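/- Let $f=\frac1n\sum_{i=1}^n f_i$ on $\mathbb{R}^d$, where each $f_i$ is convex and $L$-smooth and depends only on the coordinates in a set $T_i\subseteq[d]$, and every coordinate lies in some $T_i$. Assume the quadratic growth $f(x)-f(x^\star)\ge\frac{\mu}{2}\|x-x^\star\|^2$ for all $x$, with $\mu>0$ (as holds if $f$ is $\mu$-strongly convex with minimizer $x^\star$). Put $\kappa=L/\mu$, $\Delta=\frac1n\max_v|\{i: v\in T_i\}|$, let $P_i$ be the coordinate projection onto $T_i$, and $D=(\frac1n\sum_i P_i)^{-1}$. Consider the asynchronous lock-free method with parameters $m,\vartheta,\varphi,\eta,S,R$, started at $x_0$. Round $r=0,\dots,R-1$ starts with $\tilde x_0=z=x_r$ and consists of $S$ epochs. Epoch $s$ computes $\nabla f(\tilde x_s)$ and performs $m$ iterations, numbered $k=0,\dots,m-1$ in the order in which their reads of the shared memory $z$ are completed. Iteration $k$ draws $i_k$ uniformly from $[n]$, reads $\hat z_k$, forms $\hat y_k=\vartheta\hat z_k+(1-\vartheta)\tilde x_s-\varphi D\nabla f(\tilde x_s)$ and $\mathcal G_k=\nabla f_{i_k}(\hat y_k)-\nabla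 f_{i_k}(\tilde x_s)+P_{i_k}D\nabla f(\tilde x_s)$, and adds $-\eta\mathcal G_k$ to $z$ coordinate by coordinate with atomic writes; so $[\hat z_k]_v=[z_0]_v-\eta\sum_j[\mathcal G_j]_v$, the sum running over those $j<k$ whose coordinate $v$ was written before it was read by iteration $k$, where $z_0$ is the content of $z$ at the start of the epoch, and at the end of the epoch $z=z_0-\eta\sum_{k<m}\mathcal G_k$. Then $\tilde x_{s+1}=\hat y_t$ with $t$ uniform on $\{0,\dots,m-1\}$ and independent of the epoch, and the next epoch continues with the current $z$. Finally $x_{r+1}=\frac1S\sum_{s=0}^{S-1}\tilde x_{s+1}$. Assume (unbiasedness) that $i_k$ is independent of $\hat z_k$, jointly with $\tilde x_s$ and with $(i_j,\hat z_j)_{j<k}$, and (bounded overlaps) that the writes of iteration $j$ are completed before iteration $k$ reads whenever $k>j+\tau$. Let $\omega>1$ and $0<c_1\le c_2$. There is a constant $C$ depending only on $\omega,c_1,c_2$ such that the following holds for every such problem, every $\tilde\tau\ge\tau$, every $m$ with $c_1n\le m\le c_2n$, and every $\epsilon>0$. With $$\vartheta=\frac{\sqrt m}{\sqrt{\kappa(1+2\sqrt\Delta\tilde\tau)}+\sqrt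 m},\quad \varphi=\frac{1-\vartheta}{L},\quad \eta=\frac{1-\vartheta}{L\vartheta(1+2\sqrt\Delta\tilde\tau)},\quad S=\left\lceil2\omega\sqrt{\tfrac{\kappa}{m}(1+2\sqrt\Delta\tilde\tau)}\right\rceil$$ and a suitable number of rounds $R\le C\max\{1,\log\frac{f(x_0)-f(x^\star)}{\epsilon}\}$, the output satisfies $\mathbb E f(x_R)-f(x^\star)\le\epsilon$, and the total number of incremental gradients $\nabla f_i$ that are computed is at most $$C\max\left\{n,\sqrt{\kappa n(1+2\sqrt\Delta\tilde\tau)}\right\}\max\left\{1,\log\frac{f(x_0)-f(x^\star)}{\epsilon}\right\}$$ (where $\log 0$ is read as $0$ if $f(x_0)=f(x^\star)$). -/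

import Mathlib

open MeasureTheory ProbabilityTheory

noncomputable section

namespace AsyncSVRG

/-- The space `ℝ^d` with the Euclidean norm. -/
abbrev Vec (d : ℕ) : Type := EuclideanSpace ℝ (Fin d)

/-- The data of a finite-sum problem: the components `f_1, …, f_n` and, for each of them, the set
`T_i` of coordinates on which it is supported. -/
structure Problem (n d : ℕ) where
  f : Fin n → Vec d → ℝ
  T : Fin n → Finset (Fin d)

namespace Problem

variable {n d : ℕ}

/-- The objective `f = (1/n) ∑ f_i`. -/
def obj (p : Problem n d) (x : Vec d) : ℝ := (1 / (n : ℝ)) * ∑ i, p.f i x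

/-- The number of components whose support contains the coordinate `v`. -/
def count (p : Problem n d) (v : Fin d) : ℕ := (Finset.univ.filter fun i => v ∈ p.T i).card

/-- The sparsity measure `Δ = (1/n) max_v |{i : v ∈ T_i}|`. -/
def density (p : Problem n d) : ℝ := ((Finset.univ.sup p.count : ℕ) : ℝ) / n

/-- Each `f_i` is convex and `L`-smooth (it has an `L`-Lipschitz gradient) and depends only on the
coordinates in `T_i`; every coordinate lies in some `T_i`. -/
structure IsSparseSmoothConvex (p : Problem n d) (L : ℝ) : Prop where
  convex : ∀ i, ConvexOn ℝ Set.univ (p.f i)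
  differentiable : ∀ i, Differentiable ℝ (p.f i)
  smooth : ∀ i x y, ‖gradient (p.f i) x - gradient (p.f i) y‖ ≤ L * ‖x - y‖
  supported : ∀ i x y, (∀ v ∈ p.T i, x v = y v) → p.f i x = p.f i y
  covered : ∀ v, ∃ i, v ∈ p.T i

/-- Quadratic growth with modulus `μ` at `xs`. For `μ > 0` it makes `xs` the unique minimizer of the
objective, and it follows from `μ`-strong convexity when `xs` is the minimizer. -/
def QuadraticGrowth (p : Problem n d) (μ : ℝ) (xs : Vec d) : Prop :=
  ∀ x, μ / 2 * ‖x - xs‖ ^ 2 ≤ p.obj x - p.obj xs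

/-- Multiplication by the diagonal matrix `D = ((1/n) ∑ P_i)⁻¹`, where `P_i` is the coordinate
projection onto `T_i`: the diagonal entries of `D` are the numbers `((1/n) |{i : v ∈ T_i}|)⁻¹`. -/
def scaleD (p : Problem n d) (g : Vec d) : Vec d :=
  WithLp.toLp 2 fun v => ((1 / (n : ℝ)) * p.count v)⁻¹ * g v

/-- The coordinate projection `P_i` onto `T_i`. -/
def proj (p : Problem n d) (i : Fin n) (g : Vec d) : Vec d :=
  WithLp.toLp 2 fun v => if v ∈ p.T i then g v else 0

/-- The sparse variance-reduced estimator `𝒢_y = ∇f_i(y) - ∇f_i(x̃) + D_i ∇f(x̃)`, `D_i = P_i D`,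
for the sample `i` and the snapshot `xt = x̃`. -/
def estimator (p : Problem n d) (xt : Vec d) (i : Fin n) (y : Vec d) : Vec d :=
  gradient (p.f i) y - gradient (p.f i) xt + p.proj i (p.scaleD (gradient p.obj xt))

end Problem

/-- The scalar parameters of the method, apart from the epoch length `m`: `ϑ`, `φ`, the step
size `η`, and the number `S` of epochs in a round. -/
structure Params where
  θ : ℝ
  φ : ℝ
  η : ℝ
  S : ℕ

/-- The parameters for smoothness `L`, condition ratio `κ`, epoch length `m`, restart constant `ω`,
and asynchrony factor `a` (which is `1 + 2 √Δ τ̃`). -/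
def Params.choice (L κ a ω : ℝ) (m : ℕ) : Params where
  θ := √m / (√(κ * a) + √m)
  φ := (1 - √m / (√(κ * a) + √m)) / L
  η := (1 - √m / (√(κ * a) + √m)) / (L * (√m / (√(κ * a) + √m)) * a)
  S := ⌈2 * ω * √(κ / m * a)⌉₊

section Epoch

variable {n d : ℕ} (p : Problem n d) (par : Params)

/-- The coupling `ŷ = ϑ ẑ + (1 - ϑ) x̃ - φ D ∇f(x̃)`. -/
def couple (xt zh : Vec d) : Vec d :=
  par.θ • zh + (1 - par.θ) • xt - par.φ • p.scaleD (gradient p.obj xt)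

/-- The inconsistent read `ẑ_k` in an epoch with snapshot `xt`, initial memory content `z0` and
samples `i_0, i_1, …`; `w k j v` tells whether coordinate `v` of update `j` had been written when
iteration `k` read it:
`[ẑ_k]_v = [z_0]_v - η ∑ [𝒢_{ŷ_j}]_v`, over those `j < k` whose coordinate `v` was written. -/
def readZ (xt z0 : Vec d) (i : ℕ → Fin n) (w : ℕ → ℕ → Fin d → Bool) (k : ℕ) : Vec d :=
  WithLp.toLp 2 fun v => z0 v - par.η * ∑ j : Fin k,
    if w k j v then p.estimator xt (i j) (couple p par xt (readZ xt z0 i w j)) v else 0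
termination_by k
decreasing_by exact j.isLt

/-- The point `ŷ_k` at which iteration `k` of the epoch evaluates its gradient estimator. -/
def readY (xt z0 : Vec d) (i : ℕ → Fin n) (w : ℕ → ℕ → Fin d → Bool) (k : ℕ) : Vec d :=
  couple p par xt (readZ p par xt z0 i w k)

/-- The virtual iterates `z_{k+1} = z_k - η 𝒢_{ŷ_k}`. The last one, `z_m`, is the content of the
shared memory once all the `m` updates of the epoch have been written. -/
def virtualZ (xt z0 : Vec d) (i : ℕ → Fin n) (w : ℕ → ℕ → Fin d → Bool) : ℕ → Vec d
  | 0 => z0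
  | k + 1 => virtualZ xt z0 i w k -
      par.η • p.estimator xt (i k) (readY p par xt z0 i w k)

end Epoch

/-- The state of the method between two epochs: the snapshot `x̃_s`, the content `z` of the shared
memory, and the number of incremental gradients (of the `f_i`) computed so far. -/
structure State (d : ℕ) where
  snapshot : Vec d
  memory : Vec d
  calls : ℕ

/-- The random quantities of an execution with epochs of length `m`; `r` numbers the rounds
(restarts), `s` the epochs in a round, and `k`, `j` the iterations in an epoch, in the order in which
their reads of the shared memory are completed.
`sample r s k` is the index `i_k`; `written r s k j v` says whether the write of coordinate `v` by
iteration `j` preceded its read by iteration `k`; `pick r s` is the index `t` of the next snapshot. -/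
structure Execution (Ω : Type*) [MeasurableSpace Ω] (n d m : ℕ) where
  sample : ℕ → ℕ → ℕ → Ω → Fin n
  written : ℕ → ℕ → ℕ → ℕ → Fin d → Ω → Bool
  pick : ℕ → ℕ → Ω → Fin m
  measurable_sample : ∀ r s k, Measurable (sample r s k)
  measurable_written : ∀ r s k j v, Measurable (written r s k j v)
  measurable_pick : ∀ r s, Measurable (pick r s)

namespace Execution

variable {Ω : Type*} [MeasurableSpace Ω] {n d m : ℕ}

/-- The state after `s` epochs of round `r`, when the round starts at `x` with `c` incremental
gradients already computed. An epoch computes the full gradient `∇f(x̃_s)` (`n` incremental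
gradients) and then performs `m` iterations, each with the two incremental gradients
`∇f_{i_k}(ŷ_k)` and `∇f_{i_k}(x̃_s)`. -/
def epochs (e : Execution Ω n d m) (p : Problem n d) (par : Params) (o : Ω) (r : ℕ)
    (x : Vec d) (c : ℕ) : ℕ → State d
  | 0 => ⟨x, x, c⟩
  | s + 1 =>
    let st := e.epochs p par o r x c s
    let i : ℕ → Fin n := fun k => e.sample r s k o
    let w : ℕ → ℕ → Fin d → Bool := fun k j v => e.written r s k j v o
    { snapshot := readY p par st.snapshot st.memory i w (e.pick r s o)
      memory := virtualZ p par st.snapshot st.memory i w m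
      calls := st.calls + n + 2 * m }

/-- The restart point `x_r` after `r` rounds, with the number of incremental gradients computed up
to then; `x_{r+1} = (1/S) ∑_{s < S} x̃_{s+1}`. -/
def rounds (e : Execution Ω n d m) (p : Problem n d) (par : Params) (x₀ : Vec d) (o : Ω) :
    ℕ → Vec d × ℕ
  | 0 => (x₀, 0)
  | r + 1 =>
    let q := e.rounds p par x₀ o r
    ((1 / (par.S : ℝ)) • ∑ s ∈ Finset.range par.S, (e.epochs p par o r q.1 q.2 (s + 1)).snapshot,
      (e.epochs p par o r q.1 q.2 par.S).calls)

/-- The output `x_R` of the method with `R` rounds. -/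
def output (e : Execution Ω n d m) (p : Problem n d) (par : Params) (x₀ : Vec d) (R : ℕ)
    (o : Ω) : Vec d := (e.rounds p par x₀ o R).1

/-- The number of incremental gradients computed in `R` rounds. -/
def oracleCalls (e : Execution Ω n d m) (p : Problem n d) (par : Params) (x₀ : Vec d) (R : ℕ)
    (o : Ω) : ℕ := (e.rounds p par x₀ o R).2

/-- The state at the beginning of epoch `s` of round `r`. -/
def stateAt (e : Execution Ω n d m) (p : Problem n d) (par : Params) (x₀ : Vec d) (r s : ℕ)
    (o : Ω) : State d :=
  e.epochs p par o r (e.rounds p par x₀ o r).1 (e.rounds p par x₀ o r).2 s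

/-- The inconsistent read `ẑ_k` in epoch `s` of round `r`. -/
def zhat (e : Execution Ω n d m) (p : Problem n d) (par : Params) (x₀ : Vec d) (r s k : ℕ)
    (o : Ω) : Vec d :=
  readZ p par (e.stateAt p par x₀ r s o).snapshot (e.stateAt p par x₀ r s o).memory
    (fun j => e.sample r s j o) (fun k' j v => e.written r s k' j v o) k

/-- What has happened in epoch `s` of round `r` before iteration `k`: the snapshot `x̃_s` and
`i_j`, `ẑ_j` for `j < k`. The memory content at the start of the epoch is `ẑ_0`. -/
def history (e : Execution Ω n d m) (p : Problem n d) (par : Params) (x₀ : Vec d) (r s k : ℕ)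
    (o : Ω) : Vec d × (Fin k → Fin n × Vec d) :=
  ((e.stateAt p par x₀ r s o).snapshot,
    fun j => (e.sample r s j o, e.zhat p par x₀ r s j o))

/-- The random choices of the method in its first `R` rounds. The samples `i_k` are uniform on `[n]`,
and `i_k` is independent of the inconsistent read `ẑ_k` jointly with the history of the epoch before
iteration `k` (unbiasedness). The snapshot index is uniform on `{0, …, m - 1}` and independent of the
epoch from which it picks the next snapshot. -/
structure Unbiased (e : Execution Ω n d m) (P : Measure Ω) (p : Problem n d) (par : Params)
    (x₀ : Vec d) (R : ℕ) : Prop where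
  sample_uniform : ∀ r < R, ∀ s < par.S, ∀ k < m, ∀ a : Fin n,
    P.real {o | e.sample r s k o = a} = 1 / n
  sample_indep : ∀ r < R, ∀ s < par.S, ∀ k < m,
    IndepFun (e.sample r s k)
      (fun o => (e.history p par x₀ r s k o, e.zhat p par x₀ r s k o)) P
  pick_uniform : ∀ r < R, ∀ s < par.S, ∀ a : Fin m, P.real {o | e.pick r s o = a} = 1 / m
  pick_indep : ∀ r < R, ∀ s < par.S,
    IndepFun (e.pick r s) (e.history p par x₀ r s m) P

/-- At most `τ` iterations overlap: everything written by iteration `j` is in the shared memory when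
an iteration `k > j + τ` reads it. -/
def BoundedOverlap (e : Execution Ω n d m) (par : Params) (R τ : ℕ) : Prop :=
  ∀ r < R, ∀ s < par.S, ∀ k < m, ∀ j, j + τ < k → ∀ v o, e.written r s k j v o = true

end Execution

end AsyncSVRG

end

/-!
The virtual iterates `z_{k+1} = z_k - η 𝒢_k`, which ignore the delays, satisfy
`⟨𝒢_k, z_k - x*⟩ = (‖z_k - x*‖² - ‖z_{k+1} - x*‖²) / (2η) + (η / 2) ‖𝒢_k‖²`, a telescoping sum. A
read `ẑ_k` differs from `z_k` by parts of at most `τ` earlier updates `𝒢_j`, and `𝒢_k` is supported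
on `T_{i_k}`, so it meets `𝒢_j` only through `P_{i_k} 𝒢_j`, whose second moment is at most
`Δ E‖𝒢_j‖²` as `i_k` is independent of `𝒢_j`. Hence asynchrony only inflates the coefficient of the
second moments from `η / 2` to `(1 + 2 √Δ τ) η / 2`. On the other hand, cocoercivity of the
gradients gives a term `-(φ / 2) E‖𝒢_k‖²` in the bound for `f(ŷ_k)`, and the step size is chosen so
that it absorbs them all. What remains telescopes over the epochs of a round; quadratic growth
bounds the initial distance `‖x_r - x*‖²` by the initial gap, and the expected gap shrinks by the
factor `1 / ω`.
-/

noncomputable section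

namespace AsyncSVRG

/-! ### Maps with finitely many values -/

/-- A simple map takes finitely many values, each on a measurable set. All random quantities of the
method are simple, so that they are integrable and may be composed with arbitrary functions; for
this the codomain, unlike that of a random variable, carries no measurable structure. -/
def IsSimpleMap {Ω α : Type*} [MeasurableSpace Ω] (g : Ω → α) : Prop :=
  ∃ s : SimpleFunc Ω α, ⇑s = g

namespace IsSimpleMap

variable {Ω α β γ : Type*} [MeasurableSpace Ω]

theorem const (a : α) : IsSimpleMap fun _ : Ω => a :=
  ⟨.const Ω a, rfl⟩

theorem of_measurable [Finite α] [MeasurableSpace α] [MeasurableSingletonClass α] {g : Ω → α}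
    (hg : Measurable g) : IsSimpleMap g :=
  ⟨⟨g, fun a => hg (measurableSet_singleton a), Set.toFinite _⟩, rfl⟩

theorem comp {g : Ω → α} (hg : IsSimpleMap g) (F : α → β) : IsSimpleMap fun o => F (g o) := by
  obtain ⟨s, rfl⟩ := hg
  exact ⟨s.map F, rfl⟩

theorem comp₂ {g : Ω → α} {h : Ω → β} (hg : IsSimpleMap g) (hh : IsSimpleMap h)
    (F : α → β → γ) : IsSimpleMap fun o => F (g o) (h o) := by
  obtain ⟨s, rfl⟩ := hg
  obtain ⟨t, rfl⟩ := hh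
  exact ⟨(s.pair t).map fun x => F x.1 x.2, rfl⟩

theorem pi {ι : Type*} [Finite ι] {δ : ι → Type*} {g : ∀ i, Ω → δ i}
    (hg : ∀ i, IsSimpleMap (g i)) : IsSimpleMap fun o i => g i o := by
  choose s hs using hg
  obtain rfl : (fun i => ⇑(s i)) = g := funext hs
  refine ⟨⟨fun o i => s i o, fun f => ?_, ?_⟩, rfl⟩
  · have : (fun o i => s i o) ⁻¹' {f} = ⋂ i, s i ⁻¹' {f i} := by
      ext o
      simp [funext_iff]
    rw [this]
    exact .iInter fun i => (s i).measurableSet_fiber (f i)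
  · refine (Set.Finite.pi fun i => (s i).finite_range).subset ?_
    rintro _ ⟨o, rfl⟩ i -
    exact ⟨o, rfl⟩

theorem sum {ι M : Type*} [AddCommMonoid M] (s : Finset ι) {g : ι → Ω → M}
    (hg : ∀ i, IsSimpleMap (g i)) : IsSimpleMap fun o => ∑ i ∈ s, g i o := by
  have := (pi fun i : s => hg i).comp fun f => ∑ i, f i
  exact (funext fun o => Finset.sum_coe_sort s fun i => g i o) ▸ this

theorem measurable [MeasurableSpace α] {g : Ω → α} (hg : IsSimpleMap g) : Measurable g := by
  obtain ⟨s, rfl⟩ := hg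
  exact s.measurable

theorem integrable {P : Measure Ω} [IsFiniteMeasure P] {g : Ω → ℝ} (hg : IsSimpleMap g) :
    Integrable g P := by
  obtain ⟨s, rfl⟩ := hg
  exact s.integrable_of_isFiniteMeasure

theorem indepFun_comp [MeasurableSpace α] [MeasurableSpace β] [MeasurableSingletonClass β]
    [MeasurableSpace γ] {P : Measure Ω} {X : Ω → α} {H : Ω → β} (hH : IsSimpleMap H)
    (h : IndepFun X H P) (F : β → γ) : IndepFun X (fun o => F (H o)) P := by
  obtain ⟨s, rfl⟩ := hH
  rw [indepFun_iff_measure_inter_preimage_eq_mul] at h ⊢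
  intro A B hA _
  have hB : (fun o => F (s o)) ⁻¹' B = s ⁻¹' (Set.range s ∩ F ⁻¹' B) := by
    ext o
    simp
  rw [hB]
  exact h A _ hA (s.finite_range.inter_of_left _).measurableSet

section UniformVariable

variable [MeasurableSpace α] [MeasurableSingletonClass α] [MeasurableSpace β]
  [MeasurableSingletonClass β] {P : Measure Ω} {X : Ω → α} {H : Ω → β}

theorem integral_indicator_mul_of_indepFun (hX : Measurable X) (hH : IsSimpleMap H)
    (h : IndepFun X H P) (a : α) (F : β → ℝ) :
    ∫ o, Set.indicator {a} 1 (X o) * F (H o) ∂P = P.real {o | X o = a} * ∫ o, F (H o) ∂P := by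
  have hmeas : Measurable (Set.indicator {a} (1 : α → ℝ)) :=
    measurable_one.indicator (measurableSet_singleton a)
  have hindep : IndepFun (fun o => Set.indicator {a} (1 : α → ℝ) (X o)) (fun o => F (H o)) P :=
    (hH.indepFun_comp h F).comp hmeas measurable_id
  rw [hindep.integral_fun_mul_eq_mul_integral (hmeas.comp hX).aestronglyMeasurable
    (hH.comp F).measurable.aestronglyMeasurable]
  congr 1
  exact integral_indicator_one (hX (measurableSet_singleton a))

theorem integral_of_uniform [Fintype α] [IsFiniteMeasure P] (hX : Measurable X)
    (hH : IsSimpleMap H) (h : IndepFun X H P) {q : ℝ} (hq : ∀ a, P.real {o | X o = a} = q)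
    (ψ : α → β → ℝ) : ∫ o, ψ (X o) (H o) ∂P = ∫ o, q * ∑ a, ψ a (H o) ∂P := by
  classical
  have hint : ∀ a, Integrable (fun o => Set.indicator {a} 1 (X o) * ψ a (H o)) P := fun a =>
    ((of_measurable hX).comp₂ hH fun x b => Set.indicator {a} 1 x * ψ a b).integrable
  calc ∫ o, ψ (X o) (H o) ∂P
      = ∫ o, ∑ a, Set.indicator {a} 1 (X o) * ψ a (H o) ∂P := by
        simp [Set.indicator_apply]
    _ = ∑ a, q * ∫ o, ψ a (H o) ∂P := by
        rw [integral_finsetSum _ fun a _ => hint a]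
        exact Finset.sum_congr rfl fun a _ =>
          hq a ▸ integral_indicator_mul_of_indepFun hX hH h a (ψ a)
    _ = ∫ o, q * ∑ a, ψ a (H o) ∂P := by
        rw [integral_const_mul, integral_finsetSum _ fun a _ => (hH.comp (ψ a)).integrable,
          Finset.mul_sum]

end UniformVariable

end IsSimpleMap

/-! ### Smooth convex functions -/

section SmoothConvex

variable {E : Type*} [NormedAddCommGroup E] [InnerProductSpace ℝ E]

theorem inner_le_sq_add_sq {s : ℝ} (hs : 0 < s) (x y : E) :
    inner ℝ x y ≤ (2 * s)⁻¹ * ‖y‖ ^ 2 + s / 2 * ‖x‖ ^ 2 := by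
  have hsq : (2 * s)⁻¹ * ‖s • x - y‖ ^ 2 =
      (2 * s)⁻¹ * ‖y‖ ^ 2 + s / 2 * ‖x‖ ^ 2 - inner ℝ x y := by
    rw [norm_sub_sq_real, norm_smul, real_inner_smul_left, Real.norm_of_nonneg hs.le]
    field_simp
    ring
  have : 0 ≤ (2 * s)⁻¹ * ‖s • x - y‖ ^ 2 := by positivity
  linarith

variable [CompleteSpace E] {f : E → ℝ} {L : ℝ}

theorem hasDerivAt_comp_line (hf : Differentiable ℝ f) (x v : E) (t : ℝ) :
    HasDerivAt (fun t : ℝ => f (x + t • v)) (inner ℝ (gradient f (x + t • v)) v) t := by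
  have hline : HasDerivAt (fun t : ℝ => x + t • v) v t := by
    simpa using ((hasDerivAt_id t).smul_const v).const_add x
  have := (hf (x + t • v)).hasFDerivAt.comp_hasDerivAt t hline
  rwa [← inner_gradient_left] at this

theorem add_inner_gradient_le_of_convexOn (hc : ConvexOn ℝ Set.univ f) (hf : Differentiable ℝ f)
    (x y : E) : f y + inner ℝ (gradient f y) (x - y) ≤ f x := by
  have hline : ConvexOn ℝ Set.univ fun t : ℝ => f (y + t • (x - y)) := by
    have := hc.comp_affineMap (AffineMap.lineMap y x)
    simpa [Function.comp_def, AffineMap.lineMap_apply, add_comm] using this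
  have hslope := hline.le_slope_of_hasDerivAt (Set.mem_univ 0) (Set.mem_univ 1) zero_lt_one
    (hasDerivAt_comp_line hf y (x - y) 0)
  simp only [zero_smul, add_zero, slope_def_field, one_smul, add_sub_cancel, sub_zero,
    div_one] at hslope
  linarith

theorem le_add_inner_gradient_add_sq (hf : Differentiable ℝ f)
    (hL : ∀ x y, ‖gradient f x - gradient f y‖ ≤ L * ‖x - y‖) (x v : E) :
    f (x + v) ≤ f x + inner ℝ (gradient f x) v + L / 2 * ‖v‖ ^ 2 := by
  let g : ℝ → ℝ := fun t =>
    f (x + t • v) - t * inner ℝ (gradient f x) v - L / 2 * ‖v‖ ^ 2 * t ^ 2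
  have hg : ∀ t, HasDerivAt g (inner ℝ (gradient f (x + t • v)) v - inner ℝ (gradient f x) v
      - L / 2 * ‖v‖ ^ 2 * (2 * t)) t := by
    intro t
    have hlin := (hasDerivAt_id t).mul_const (inner ℝ (gradient f x) v)
    have hquad := (hasDerivAt_pow 2 t).const_mul (L / 2 * ‖v‖ ^ 2)
    simpa [-inner_gradient_left] using
      ((hasDerivAt_comp_line hf x v t).fun_sub hlin).fun_sub hquad
  have hanti : AntitoneOn g (Set.Icc 0 1) := by
    refine antitoneOn_of_deriv_nonpos (convex_Icc 0 1)
      (fun t _ => (hg t).continuousAt.continuousWithinAt)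
      (fun t _ => (hg t).differentiableAt.differentiableWithinAt) fun t ht => ?_
    rw [interior_Icc] at ht
    rw [(hg t).deriv, ← inner_sub_left]
    have hcs := real_inner_le_norm (gradient f (x + t • v) - gradient f x) v
    have hlip := hL (x + t • v) x
    rw [add_sub_cancel_left, norm_smul, Real.norm_of_nonneg ht.1.le] at hlip
    nlinarith [mul_le_mul_of_nonneg_right hlip (norm_nonneg v)]
  have := hanti (Set.left_mem_Icc.2 zero_le_one) (Set.right_mem_Icc.2 zero_le_one) zero_le_one
  simp only [g, one_smul, zero_smul, add_zero, one_mul, zero_mul, one_pow, mul_one, ne_eq,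
    OfNat.ofNat_ne_zero, not_false_eq_true, zero_pow, mul_zero, sub_zero] at this
  linarith

-- Cocoercivity: compare `f` at the gradient step `x - u / L`, where `u = ∇f(x) - ∇f(y)`, with its
-- quadratic upper bound at `x` and its linear lower bound at `y`.
theorem norm_gradient_sub_sq_le_of_convexOn (hc : ConvexOn ℝ Set.univ f)
    (hf : Differentiable ℝ f) (hL0 : 0 < L)
    (hL : ∀ x y, ‖gradient f x - gradient f y‖ ≤ L * ‖x - y‖) (x y : E) :
    ‖gradient f y - gradient f x‖ ^ 2 ≤
      2 * L * (f x - f y - inner ℝ (gradient f y) (x - y)) := by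
  set u := gradient f x - gradient f y with hu
  have hupper := le_add_inner_gradient_add_sq hf hL x (-(1 / L) • u)
  have hlower := add_inner_gradient_le_of_convexOn hc hf (x + -(1 / L) • u) y
  rw [add_sub_right_comm, inner_add_right] at hlower
  rw [norm_smul, norm_neg, mul_pow, Real.norm_of_nonneg (by positivity)] at hupper
  rw [inner_smul_right] at hupper hlower
  have hsq : 1 / L * inner ℝ (gradient f x) u - 1 / L * inner ℝ (gradient f y) u =
      1 / L * ‖u‖ ^ 2 := by
    rw [← mul_sub, ← inner_sub_left, ← hu, real_inner_self_eq_norm_sq]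
  have hstep : 1 / L * ‖u‖ ^ 2 - L / 2 * ((1 / L) ^ 2 * ‖u‖ ^ 2) = ‖u‖ ^ 2 / (2 * L) := by
    field_simp
    ring
  have hgap : ‖u‖ ^ 2 / (2 * L) ≤ f x - f y - inner ℝ (gradient f y) (x - y) := by
    linarith
  rwa [div_le_iff₀' (by positivity), norm_sub_rev] at hgap

end SmoothConvex

/-! ### The sparse estimator -/

theorem inner_eq_sum {d : ℕ} (x y : Vec d) : inner ℝ x y = ∑ v, x v * y v := by
  simp [PiLp.inner_apply, mul_comm]

namespace Problem

variable {n d : ℕ} (p : Problem n d)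

theorem count_div_le_density (v : Fin d) : 1 / (n : ℝ) * p.count v ≤ p.density := by
  rw [density, one_div_mul_eq_div]
  gcongr
  exact Finset.le_sup (Finset.mem_univ v)

theorem density_nonneg : 0 ≤ p.density := by
  unfold density
  positivity

theorem proj_apply (i : Fin n) (g : Vec d) (v : Fin d) :
    p.proj i g v = if v ∈ p.T i then g v else 0 := rfl

theorem inner_proj_right (i : Fin n) (x y : Vec d) :
    inner ℝ x (p.proj i y) = inner ℝ (p.proj i x) y := by
  simp [inner_eq_sum, proj_apply]

theorem norm_proj_sq (i : Fin n) (g : Vec d) : ‖p.proj i g‖ ^ 2 = inner ℝ (p.proj i g) g := by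
  rw [← real_inner_self_eq_norm_sq, inner_proj_right]
  simp [inner_eq_sum, proj_apply]

theorem sum_proj_apply (g : Vec d) (v : Fin d) : ∑ i, p.proj i g v = p.count v * g v := by
  simp_rw [proj_apply]
  rw [← Finset.sum_filter, Finset.sum_const, nsmul_eq_mul]
  rfl

theorem mean_norm_proj_sq_le (g : Vec d) :
    1 / (n : ℝ) * ∑ i, ‖p.proj i g‖ ^ 2 ≤ p.density * ‖g‖ ^ 2 := by
  simp_rw [norm_proj_sq, inner_eq_sum]
  rw [Finset.sum_comm, EuclideanSpace.real_norm_sq_eq, Finset.mul_sum, Finset.mul_sum]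
  refine Finset.sum_le_sum fun v _ => ?_
  rw [← Finset.sum_mul, sum_proj_apply, mul_assoc, ← sq, ← mul_assoc]
  exact mul_le_mul_of_nonneg_right (p.count_div_le_density v) (sq_nonneg _)

theorem inner_scaleD_nonneg (g : Vec d) : 0 ≤ inner ℝ g (p.scaleD g) := by
  rw [inner_eq_sum]
  refine Finset.sum_nonneg fun v _ => ?_
  rw [scaleD, mul_left_comm]
  exact mul_nonneg (by positivity) (mul_self_nonneg _)

namespace IsSparseSmoothConvex

variable {p} {L : ℝ} (h : p.IsSparseSmoothConvex L)
include h

theorem count_pos (v : Fin d) : 0 < p.count v := by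
  obtain ⟨i, hi⟩ := h.covered v
  exact Finset.card_pos.2 ⟨i, by simpa using hi⟩

theorem components_pos (v : Fin d) : 0 < n :=
  (h.covered v).choose.pos

theorem density_pos (v : Fin d) : 0 < p.density := by
  have hn := h.components_pos v
  have hv := h.count_pos v
  exact lt_of_lt_of_le (by positivity) (p.count_div_le_density v)

theorem gradient_apply_eq_zero (i : Fin n) (x : Vec d) {v : Fin d} (hv : v ∉ p.T i) :
    gradient (p.f i) x v = 0 := by
  have hderiv := hasDerivAt_comp_line (h.differentiable i) x (EuclideanSpace.single v 1) 0
  have hconst : (fun t : ℝ => p.f i (x + t • EuclideanSpace.single v 1)) = fun _ => p.f i x := by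
    funext t
    refine h.supported i _ _ fun u hu => ?_
    have : u ≠ v := fun e => hv (e ▸ hu)
    simp [this]
  rw [hconst] at hderiv
  have := hderiv.unique (hasDerivAt_const _ _)
  simpa [inner_eq_sum, -inner_gradient_left, Pi.single_apply] using this

theorem proj_gradient (i : Fin n) (x : Vec d) :
    p.proj i (gradient (p.f i) x) = gradient (p.f i) x := by
  ext v
  rw [proj_apply, ite_eq_left_iff]
  exact fun hv => (h.gradient_apply_eq_zero i x hv).symm

theorem hasGradientAt_obj (x : Vec d) :
    HasGradientAt p.obj ((1 / (n : ℝ)) • ∑ i, gradient (p.f i) x) x := by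
  rw [hasGradientAt_iff_hasFDerivAt]
  have := (HasFDerivAt.fun_sum (u := Finset.univ) fun i _ =>
    (h.differentiable i x).hasGradientAt.hasFDerivAt).const_mul (1 / (n : ℝ))
  rw [show p.obj = fun y => 1 / (n : ℝ) * ∑ i, p.f i y from rfl]
  simpa [map_smul, map_sum] using this

theorem gradient_obj (x : Vec d) :
    gradient p.obj x = (1 / (n : ℝ)) • ∑ i, gradient (p.f i) x :=
  (h.hasGradientAt_obj x).gradient

theorem differentiable_obj : Differentiable ℝ p.obj :=
  fun x => (h.hasGradientAt_obj x).differentiableAt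

theorem convexOn_obj : ConvexOn ℝ Set.univ p.obj := by
  have : ∀ s : Finset (Fin n), ConvexOn ℝ Set.univ fun x => ∑ i ∈ s, p.f i x := by
    intro s
    induction s using Finset.cons_induction with
    | empty => simpa using convexOn_const (0 : ℝ) convex_univ
    | cons a s ha ih =>
      simp_rw [Finset.sum_cons]
      exact (h.convex a).add ih
  exact (this Finset.univ).smul (by positivity : 0 ≤ 1 / (n : ℝ))

theorem mean_proj_scaleD (g : Vec d) : (1 / (n : ℝ)) • ∑ i, p.proj i (p.scaleD g) = g := by
  ext v
  have hn := h.components_pos v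
  have hv := h.count_pos v
  simp only [PiLp.smul_apply, WithLp.ofLp_sum, Finset.sum_apply, smul_eq_mul, sum_proj_apply]
  rw [scaleD]
  field_simp

theorem mean_estimator (xt y : Vec d) :
    (1 / (n : ℝ)) • ∑ i, p.estimator xt i y = gradient p.obj y := by
  simp only [estimator, Finset.sum_add_distrib, Finset.sum_sub_distrib, smul_add, smul_sub]
  rw [h.mean_proj_scaleD, ← h.gradient_obj, ← h.gradient_obj]
  abel

theorem mean_inner_estimator (xt y u : Vec d) :
    1 / (n : ℝ) * ∑ i, inner ℝ (p.estimator xt i y) u = inner ℝ (gradient p.obj y) u := by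
  rw [← sum_inner, ← real_inner_smul_left, h.mean_estimator]

theorem estimator_apply_eq_zero (xt y : Vec d) (i : Fin n) {v : Fin d} (hv : v ∉ p.T i) :
    p.estimator xt i y v = 0 := by
  simp [estimator, h.gradient_apply_eq_zero i _ hv, proj_apply, hv]

theorem norm_estimator_sq_le (hL : 0 < L) (xt y : Vec d) (i : Fin n) :
    let u := p.scaleD (gradient p.obj xt)
    ‖p.estimator xt i y‖ ^ 2 ≤
      2 * L * (p.f i xt - p.f i y - inner ℝ (gradient (p.f i) y) (xt - y)) +
        2 * inner ℝ (gradient (p.f i) y - gradient (p.f i) xt) u + inner ℝ (p.proj i u) u := by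
  intro u
  have hinner : inner ℝ (gradient (p.f i) y - gradient (p.f i) xt) (p.proj i u) =
      inner ℝ (gradient (p.f i) y - gradient (p.f i) xt) u := by
    simp only [inner_sub_left, inner_proj_right, h.proj_gradient]
  rw [estimator, norm_add_sq_real, hinner, norm_proj_sq]
  linarith [norm_gradient_sub_sq_le_of_convexOn (h.convex i) (h.differentiable i) hL
    (h.smooth i) xt y]

theorem mean_norm_estimator_sq_le (hL : 0 < L) (xt y : Vec d) :
    1 / (n : ℝ) * ∑ i, ‖p.estimator xt i y‖ ^ 2 ≤
      2 * L * (p.obj xt - p.obj y - inner ℝ (gradient p.obj y) (xt - y)) +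
        2 * inner ℝ (gradient p.obj y) (p.scaleD (gradient p.obj xt)) := by
  set g := gradient p.obj xt with hg
  set u := p.scaleD g with hu
  calc 1 / (n : ℝ) * ∑ i, ‖p.estimator xt i y‖ ^ 2
      ≤ 1 / (n : ℝ) * ∑ i, (2 * L * (p.f i xt - p.f i y -
        inner ℝ (gradient (p.f i) y) (xt - y)) +
        2 * inner ℝ (gradient (p.f i) y - gradient (p.f i) xt) u +
        inner ℝ (p.proj i u) u) := by
        gcongr with i
        exact h.norm_estimator_sq_le hL xt y i
    _ = 2 * L * (p.obj xt - p.obj y - inner ℝ (gradient p.obj y) (xt - y)) +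
        2 * inner ℝ (gradient p.obj y - g) u +
        inner ℝ ((1 / (n : ℝ)) • ∑ i, p.proj i u) u := by
        simp only [hg, h.gradient_obj, obj, Finset.sum_add_distrib, ← Finset.mul_sum,
          Finset.sum_sub_distrib, ← sum_inner, inner_sub_left, real_inner_smul_left]
        ring
    _ = 2 * L * (p.obj xt - p.obj y - inner ℝ (gradient p.obj y) (xt - y)) +
        2 * inner ℝ (gradient p.obj y) u - inner ℝ g u := by
        rw [hu, h.mean_proj_scaleD, inner_sub_left]
        ring
    _ ≤ _ := sub_le_self _ (p.inner_scaleD_nonneg g)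

-- The term `-φ D ∇f(x̃)` of the coupling is what cancels the inner product in
-- `mean_norm_estimator_sq_le`.
theorem obj_couple_sub_le (hL : 0 < L) {par : Params} (hθ : 0 ≤ par.θ) (hφ : 0 ≤ par.φ)
    (hφL : par.φ * L = 1 - par.θ) (xt zh xs : Vec d) :
    p.obj (couple p par xt zh) - p.obj xs ≤ (1 - par.θ) * (p.obj xt - p.obj xs) +
      par.θ * inner ℝ (gradient p.obj (couple p par xt zh)) (zh - xs) -
      par.φ / 2 * (1 / (n : ℝ) * ∑ i, ‖p.estimator xt i (couple p par xt zh)‖ ^ 2) := by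
  set y := couple p par xt zh with hy
  set u := p.scaleD (gradient p.obj xt) with hu
  have hconvex : p.obj y - p.obj xs ≤ inner ℝ (gradient p.obj y) (y - xs) := by
    have := add_inner_gradient_le_of_convexOn h.convexOn_obj h.differentiable_obj xs y
    rw [← neg_sub y xs, inner_neg_right] at this
    linarith
  have hcouple : par.θ • (y - xs) = par.θ • (zh - xs) + (1 - par.θ) • (xt - y) - par.φ • u := by
    rw [hy, couple, ← hu]
    module
  have hinner := congrArg (inner ℝ (gradient p.obj y)) hcouple
  simp only [inner_add_right, inner_sub_right _ _ (par.φ • u), real_inner_smul_right] at hinner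
  have hmoment := mul_le_mul_of_nonneg_left (h.mean_norm_estimator_sq_le hL xt y)
    (by positivity : 0 ≤ par.φ / 2)
  rw [mul_add, ← mul_assoc _ (2 * L), show par.φ / 2 * (2 * L) = 1 - par.θ by linarith, ← hu]
    at hmoment
  linarith [mul_le_mul_of_nonneg_left hconvex hθ]

end IsSparseSmoothConvex

end Problem

/-! ### Inconsistent reads -/

/-- The part of the update `g` that a read misses, when `b v` tells whether the read has seen the
write of coordinate `v`. -/
def missed {d : ℕ} (b : Fin d → Bool) (g : Vec d) : Vec d :=
  WithLp.toLp 2 fun v => if b v then 0 else g v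

theorem missed_apply {d : ℕ} (b : Fin d → Bool) (g : Vec d) (v : Fin d) :
    missed b g v = if b v then 0 else g v := rfl

theorem missed_eq_zero {d : ℕ} {b : Fin d → Bool} (hb : ∀ v, b v = true) (g : Vec d) :
    missed b g = 0 := by
  ext v
  simp [missed_apply, hb v]

theorem norm_missed_le {d : ℕ} (b : Fin d → Bool) (g : Vec d) : ‖missed b g‖ ≤ ‖g‖ := by
  rw [EuclideanSpace.norm_eq, EuclideanSpace.norm_eq]
  gcongr with v
  rw [missed_apply]
  split_ifs <;> simp

section Reads

variable {n d : ℕ} {p : Problem n d}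

theorem readZ_sub_virtualZ (par : Params) (xt z0 : Vec d) (i : ℕ → Fin n)
    (w : ℕ → ℕ → Fin d → Bool) (k : ℕ) :
    readZ p par xt z0 i w k - virtualZ p par xt z0 i w k = par.η • ∑ j ∈ Finset.range k,
      missed (w k j) (p.estimator xt (i j) (readY p par xt z0 i w j)) := by
  set G : ℕ → Vec d := fun j => p.estimator xt (i j) (readY p par xt z0 i w j)
  have hvirtual : virtualZ p par xt z0 i w k = z0 - par.η • ∑ j ∈ Finset.range k, G j := by
    induction k with
    | zero => simp [virtualZ]
    | succ k ih => rw [virtualZ, ih, Finset.sum_range_succ, smul_add, sub_sub]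
  ext v
  have hread : readZ p par xt z0 i w k v =
      z0 v - par.η * ∑ j ∈ Finset.range k, if w k j v then G j v else 0 := by
    rw [readZ, ← Fin.sum_univ_eq_sum_range fun j => if w k j v then G j v else 0]
    rfl
  simp only [PiLp.sub_apply, PiLp.smul_apply, WithLp.ofLp_sum, Finset.sum_apply, smul_eq_mul,
    hvirtual, hread, missed_apply]
  rw [sub_sub_sub_cancel_left, ← mul_sub, ← Finset.sum_sub_distrib]
  congr 1
  refine Finset.sum_congr rfl fun j _ => ?_
  split_ifs <;> simp [G]

theorem Problem.inner_missed_le (i : Fin n) {s : ℝ} (hs : 0 < s) {x : Vec d}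
    (hx : ∀ v ∉ p.T i, x v = 0) (b : Fin d → Bool) (g : Vec d) :
    inner ℝ x (missed b g) ≤ (2 * s)⁻¹ * ‖p.proj i g‖ ^ 2 + s / 2 * ‖x‖ ^ 2 := by
  have hproj : inner ℝ x (missed b g) = inner ℝ x (missed b (p.proj i g)) := by
    rw [inner_eq_sum, inner_eq_sum]
    refine Finset.sum_congr rfl fun v _ => ?_
    by_cases hv : v ∈ p.T i
    · simp only [missed_apply, proj_apply, if_pos hv]
    · simp only [hx v hv, zero_mul]
  calc inner ℝ x (missed b g)
      ≤ (2 * s)⁻¹ * ‖missed b (p.proj i g)‖ ^ 2 + s / 2 * ‖x‖ ^ 2 :=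
        hproj ▸ inner_le_sq_add_sq hs x _
    _ ≤ _ := by
        gcongr
        exact norm_missed_le b _

end Reads

theorem sum_overlap_le {a : ℕ → ℝ} (ha : ∀ k, 0 ≤ a k) (m τ : ℕ) :
    ∑ k ∈ Finset.range m, ∑ j ∈ Finset.Ico (k - τ) k, (a j + a k) ≤
      2 * τ * ∑ k ∈ Finset.range m, a k := by
  have hlater : ∑ k ∈ Finset.range m, ∑ _j ∈ Finset.Ico (k - τ) k, a k ≤
      τ * ∑ k ∈ Finset.range m, a k := by
    rw [Finset.mul_sum]
    refine Finset.sum_le_sum fun k _ => ?_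
    rw [Finset.sum_const, nsmul_eq_mul, Nat.card_Ico]
    gcongr
    · exact ha k
    · omega
  have hearlier : ∑ k ∈ Finset.range m, ∑ j ∈ Finset.Ico (k - τ) k, a j ≤
      τ * ∑ k ∈ Finset.range m, a k := by
    rw [Finset.sum_comm' (t' := Finset.range m)
      (s' := fun j => Finset.Ico (j + 1) (min m (j + τ + 1)))
      (h := fun k j => by simp only [Finset.mem_range, Finset.mem_Ico]; omega), Finset.mul_sum]
    refine Finset.sum_le_sum fun j _ => ?_
    rw [Finset.sum_const, nsmul_eq_mul, Nat.card_Ico]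
    gcongr
    · exact ha j
    · omega
  simp_rw [Finset.sum_add_distrib]
  linarith

/-! ### The expected progress of an epoch -/

/-- A random epoch of the method for the problem `p` with parameters `par`: the snapshot `x̃`, the
memory content `z_0` at the start, the samples `i_k`, and the indicators that the write of
coordinate `v` by iteration `j` preceded its read by iteration `k`. It isolates one epoch from the
rounds of an `Execution`. -/
structure RandomEpoch (Ω : Type*) [MeasurableSpace Ω] {n d : ℕ} (p : Problem n d)
    (par : Params) where
  snapshot : Ω → Vec d
  memory : Ω → Vec d
  sample : ℕ → Ω → Fin n
  written : ℕ → ℕ → Fin d → Ω → Bool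
  isSimpleMap_snapshot : IsSimpleMap snapshot
  isSimpleMap_memory : IsSimpleMap memory
  measurable_sample : ∀ k, Measurable (sample k)
  measurable_written : ∀ k j v, Measurable (written k j v)

namespace RandomEpoch

variable {Ω : Type*} [MeasurableSpace Ω] {n d : ℕ} {p : Problem n d} {par : Params}
  (E : RandomEpoch Ω p par)

/-- The inconsistent read `ẑ_k`. -/
def read (k : ℕ) (o : Ω) : Vec d :=
  readZ p par (E.snapshot o) (E.memory o) (fun j => E.sample j o) (fun k j v => E.written k j v o) k

/-- The point `ŷ_k` at which iteration `k` evaluates its estimator. -/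
def point (k : ℕ) (o : Ω) : Vec d :=
  couple p par (E.snapshot o) (E.read k o)

/-- The estimator `𝒢_k` computed by iteration `k`. -/
def direction (k : ℕ) (o : Ω) : Vec d :=
  p.estimator (E.snapshot o) (E.sample k o) (E.point k o)

/-- The virtual iterate `z_k = z_0 - η ∑_{j < k} 𝒢_j`, the memory content if all the writes of
earlier iterations were complete. -/
def virtual (k : ℕ) (o : Ω) : Vec d :=
  virtualZ p par (E.snapshot o) (E.memory o) (fun j => E.sample j o)
    (fun k j v => E.written k j v o) k

/-- The snapshot together with `i_j` and `ẑ_j` for `j < k`. -/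
def past (k : ℕ) (o : Ω) : Vec d × (Fin k → Fin n × Vec d) :=
  (E.snapshot o, fun j => (E.sample j o, E.read j o))

/-- Unbiasedness of the first `m` iterations: `i_k` is uniform and independent of `ẑ_k` jointly with
the past. -/
structure IsUnbiased (P : Measure Ω) (m : ℕ) : Prop where
  sample_uniform : ∀ k < m, ∀ a : Fin n, P.real {o | E.sample k o = a} = 1 / n
  sample_indep : ∀ k < m, IndepFun (E.sample k) (fun o => (E.past k o, E.read k o)) P

/-- Bounded overlaps among the first `m` iterations: iteration `k` sees all the writes of the
iterations `j < k - τ`. -/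
def HasOverlapLE (m τ : ℕ) : Prop :=
  ∀ k < m, ∀ j, j + τ < k → ∀ v o, E.written k j v o = true

theorem isSimpleMap_sample (k : ℕ) : IsSimpleMap (E.sample k) :=
  .of_measurable (E.measurable_sample k)

theorem isSimpleMap_written (k j : ℕ) (v : Fin d) : IsSimpleMap (E.written k j v) :=
  .of_measurable (E.measurable_written k j v)

theorem isSimpleMap_read (k : ℕ) : IsSimpleMap (E.read k) := by
  induction k using Nat.strong_induction_on with
  | _ k ih =>
    have hcoord : ∀ v, IsSimpleMap fun o => E.memory o v - par.η * ∑ j : Fin k,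
        if E.written k j v o then E.direction j o v else 0 := by
      intro v
      refine E.isSimpleMap_memory.comp₂ (.sum Finset.univ fun j : Fin k => ?_)
        fun z c => z v - par.η * c
      have hpoint := E.isSimpleMap_snapshot.comp₂ (ih j j.isLt) fun x z => (x, couple p par x z)
      have hdirection := hpoint.comp₂ (E.isSimpleMap_sample j) fun x a => p.estimator x.1 a x.2 v
      exact (E.isSimpleMap_written k j v).comp₂ hdirection fun b c => if b then c else 0
    convert (IsSimpleMap.pi hcoord).comp (WithLp.toLp 2) using 2 with o
    rw [read, readZ]
    rfl

theorem isSimpleMap_point (k : ℕ) : IsSimpleMap (E.point k) :=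
  E.isSimpleMap_snapshot.comp₂ (E.isSimpleMap_read k) (couple p par)

theorem isSimpleMap_direction (k : ℕ) : IsSimpleMap (E.direction k) :=
  (E.isSimpleMap_snapshot.comp₂ (E.isSimpleMap_point k) Prod.mk).comp₂ (E.isSimpleMap_sample k)
    fun x a => p.estimator x.1 a x.2

theorem virtual_succ (k : ℕ) (o : Ω) :
    E.virtual (k + 1) o = E.virtual k o - par.η • E.direction k o := rfl

theorem isSimpleMap_virtual (k : ℕ) : IsSimpleMap (E.virtual k) := by
  induction k with
  | zero => exact E.isSimpleMap_memory
  | succ k ih => exact ih.comp₂ (E.isSimpleMap_direction k) fun z g => z - par.η • g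

theorem isSimpleMap_past (k : ℕ) : IsSimpleMap (E.past k) :=
  E.isSimpleMap_snapshot.comp₂ (.pi fun j : Fin k =>
    (E.isSimpleMap_sample j).comp₂ (E.isSimpleMap_read j) Prod.mk) Prod.mk

variable {E} {m τ : ℕ}

theorem HasOverlapLE.read_sub_virtual (hov : E.HasOverlapLE m τ) {k : ℕ} (hk : k < m) (o : Ω) :
    E.read k o - E.virtual k o = par.η • ∑ j ∈ Finset.Ico (k - τ) k,
      missed (fun v => E.written k j v o) (E.direction j o) := by
  refine (readZ_sub_virtualZ par _ _ _ _ k).trans ?_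
  congr 1
  refine (Finset.sum_subset (fun j hj => ?_) fun j hj hj' => ?_).symm
  · exact Finset.mem_range.2 (Finset.mem_Ico.1 hj).2
  · simp only [Finset.mem_range, Finset.mem_Ico] at hj hj'
    exact missed_eq_zero (fun v => hov k hk j (by omega) v o) _

section Expectation

variable {P : Measure Ω} [IsProbabilityMeasure P] {L : ℝ} {k : ℕ}

theorem integrable_norm_direction_sq : Integrable (fun o => ‖E.direction k o‖ ^ 2) P :=
  ((E.isSimpleMap_direction k).comp fun g => ‖g‖ ^ 2).integrable

theorem IsUnbiased.integral_sample (hE : E.IsUnbiased P m) (hk : k < m)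
    (ψ : Fin n → (Vec d × (Fin k → Fin n × Vec d)) × Vec d → ℝ) :
    ∫ o, ψ (E.sample k o) (E.past k o, E.read k o) ∂P =
      ∫ o, 1 / (n : ℝ) * ∑ a, ψ a (E.past k o, E.read k o) ∂P :=
  haveI : MeasurableSingletonClass (Vec d × (Fin k → Fin n × Vec d)) := inferInstance
  IsSimpleMap.integral_of_uniform (E.measurable_sample k)
    ((E.isSimpleMap_past k).comp₂ (E.isSimpleMap_read k) Prod.mk)
    (hE.sample_indep k hk) (hE.sample_uniform k hk) ψ

theorem IsUnbiased.integral_inner_direction (hE : E.IsUnbiased P m)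
    (h : p.IsSparseSmoothConvex L) (hk : k < m) (xs : Vec d) :
    ∫ o, inner ℝ (E.direction k o) (E.read k o - xs) ∂P =
      ∫ o, inner ℝ (gradient p.obj (E.point k o)) (E.read k o - xs) ∂P := by
  refine (hE.integral_sample hk fun a b =>
    inner ℝ (p.estimator b.1.1 a (couple p par b.1.1 b.2)) (b.2 - xs)).trans ?_
  exact integral_congr_ae (.of_forall fun o => h.mean_inner_estimator _ _ _)

theorem IsUnbiased.integral_norm_direction_sq (hE : E.IsUnbiased P m) (hk : k < m) :
    ∫ o, ‖E.direction k o‖ ^ 2 ∂P =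
      ∫ o, 1 / (n : ℝ) * ∑ a, ‖p.estimator (E.snapshot o) a (E.point k o)‖ ^ 2 ∂P :=
  hE.integral_sample hk fun a b => ‖p.estimator b.1.1 a (couple p par b.1.1 b.2)‖ ^ 2

theorem IsUnbiased.integral_norm_proj_direction_sq_le (hE : E.IsUnbiased P m) {j : ℕ}
    (hj : j < k) (hk : k < m) :
    ∫ o, ‖p.proj (E.sample k o) (E.direction j o)‖ ^ 2 ∂P ≤
      p.density * ∫ o, ‖E.direction j o‖ ^ 2 ∂P := by
  have hG := E.isSimpleMap_direction j
  rw [← integral_const_mul]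
  refine (hE.integral_sample hk fun a b => ‖p.proj a (p.estimator b.1.1 (b.1.2 ⟨j, hj⟩).1
    (couple p par b.1.1 (b.1.2 ⟨j, hj⟩).2))‖ ^ 2).trans_le ?_
  exact integral_mono (hG.comp fun g => 1 / (n : ℝ) * ∑ a, ‖p.proj a g‖ ^ 2).integrable
    (hG.comp fun g => p.density * ‖g‖ ^ 2).integrable fun o => p.mean_norm_proj_sq_le _

theorem IsUnbiased.integral_inner_missed_le (hE : E.IsUnbiased P m)
    (h : p.IsSparseSmoothConvex L) {j : ℕ} (hj : j < k) (hk : k < m) :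
    ∫ o, inner ℝ (E.direction k o) (missed (fun v => E.written k j v o) (E.direction j o)) ∂P ≤
      √p.density / 2 * (∫ o, ‖E.direction j o‖ ^ 2 ∂P + ∫ o, ‖E.direction k o‖ ^ 2 ∂P) := by
  rcases isEmpty_or_nonempty (Fin d) with hd | ⟨⟨v⟩⟩
  · simp [Subsingleton.elim _ (0 : Vec d)]
  have hs : 0 < √p.density := Real.sqrt_pos.2 (h.density_pos v)
  have hmissed : IsSimpleMap fun o =>
      missed (fun v => E.written k j v o) (E.direction j o) :=
    (IsSimpleMap.pi (E.isSimpleMap_written k j)).comp₂ (E.isSimpleMap_direction j) missed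
  have hproj : Integrable
      (fun o => (2 * √p.density)⁻¹ * ‖p.proj (E.sample k o) (E.direction j o)‖ ^ 2) P :=
    ((E.isSimpleMap_sample k).comp₂ (E.isSimpleMap_direction j)
      fun i g => (2 * √p.density)⁻¹ * ‖p.proj i g‖ ^ 2).integrable
  calc ∫ o, inner ℝ (E.direction k o) (missed (fun v => E.written k j v o) (E.direction j o)) ∂P
      ≤ ∫ o, ((2 * √p.density)⁻¹ * ‖p.proj (E.sample k o) (E.direction j o)‖ ^ 2 +
          √p.density / 2 * ‖E.direction k o‖ ^ 2) ∂P :=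
        integral_mono ((E.isSimpleMap_direction k).comp₂ hmissed (inner ℝ)).integrable
          (hproj.add (integrable_norm_direction_sq.const_mul _)) fun o =>
          Problem.inner_missed_le _ hs (fun _ hv => h.estimator_apply_eq_zero _ _ _ hv) _ _
    _ = (2 * √p.density)⁻¹ * ∫ o, ‖p.proj (E.sample k o) (E.direction j o)‖ ^ 2 ∂P +
          √p.density / 2 * ∫ o, ‖E.direction k o‖ ^ 2 ∂P := by
        rw [integral_add hproj (integrable_norm_direction_sq.const_mul _), integral_const_mul,
          integral_const_mul]
    _ ≤ (2 * √p.density)⁻¹ * (√p.density ^ 2 * ∫ o, ‖E.direction j o‖ ^ 2 ∂P) +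
          √p.density / 2 * ∫ o, ‖E.direction k o‖ ^ 2 ∂P := by
        rw [Real.sq_sqrt p.density_nonneg]
        gcongr
        exact hE.integral_norm_proj_direction_sq_le hj hk
    _ = _ := by field_simp

theorem IsUnbiased.integral_inner_read_sub_virtual_le (hE : E.IsUnbiased P m)
    (hov : E.HasOverlapLE m τ) (h : p.IsSparseSmoothConvex L) (hη : 0 ≤ par.η) (hk : k < m) :
    ∫ o, inner ℝ (E.direction k o) (E.read k o - E.virtual k o) ∂P ≤
      par.η * (√p.density / 2) * ∑ j ∈ Finset.Ico (k - τ) k,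
        (∫ o, ‖E.direction j o‖ ^ 2 ∂P + ∫ o, ‖E.direction k o‖ ^ 2 ∂P) := by
  have hint : ∀ j, Integrable (fun o => inner ℝ (E.direction k o)
      (missed (fun v => E.written k j v o) (E.direction j o))) P := fun j =>
    ((E.isSimpleMap_direction k).comp₂ ((IsSimpleMap.pi (E.isSimpleMap_written k j)).comp₂
      (E.isSimpleMap_direction j) missed) (inner ℝ)).integrable
  simp_rw [hov.read_sub_virtual hk, real_inner_smul_right, inner_sum]
  rw [integral_const_mul, integral_finsetSum _ fun j _ => hint j, mul_assoc]
  refine mul_le_mul_of_nonneg_left ?_ hη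
  rw [Finset.mul_sum]
  exact Finset.sum_le_sum fun j hj => hE.integral_inner_missed_le h (Finset.mem_Ico.1 hj).2 hk

theorem integral_inner_virtual_sub (hη : par.η ≠ 0) (xs : Vec d) :
    ∫ o, inner ℝ (E.direction k o) (E.virtual k o - xs) ∂P =
      1 / (2 * par.η) * (∫ o, ‖E.virtual k o - xs‖ ^ 2 ∂P -
        ∫ o, ‖E.virtual (k + 1) o - xs‖ ^ 2 ∂P) +
      par.η / 2 * ∫ o, ‖E.direction k o‖ ^ 2 ∂P := by
  have hdist : ∀ k, Integrable (fun o => ‖E.virtual k o - xs‖ ^ 2) P := fun k =>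
    ((E.isSimpleMap_virtual k).comp fun z => ‖z - xs‖ ^ 2).integrable
  have hpoint : ∀ o, inner ℝ (E.direction k o) (E.virtual k o - xs) =
      1 / (2 * par.η) * (‖E.virtual k o - xs‖ ^ 2 - ‖E.virtual (k + 1) o - xs‖ ^ 2) +
        par.η / 2 * ‖E.direction k o‖ ^ 2 := by
    intro o
    rw [virtual_succ, sub_right_comm, norm_sub_sq_real (E.virtual k o - xs), norm_smul,
      real_inner_smul_right, real_inner_comm, mul_pow, Real.norm_eq_abs, sq_abs]
    field_simp
    ring
  simp_rw [hpoint]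
  rw [← integral_sub (hdist k) (hdist (k + 1)), ← integral_const_mul, ← integral_const_mul]
  exact integral_add (((hdist k).sub (hdist (k + 1))).const_mul _)
    (integrable_norm_direction_sq.const_mul _)

theorem IsUnbiased.integral_inner_gradient_le (hE : E.IsUnbiased P m)
    (hov : E.HasOverlapLE m τ) (h : p.IsSparseSmoothConvex L) (hη : 0 < par.η) (hk : k < m)
    (xs : Vec d) :
    ∫ o, inner ℝ (gradient p.obj (E.point k o)) (E.read k o - xs) ∂P ≤
      par.η * (√p.density / 2) * ∑ j ∈ Finset.Ico (k - τ) k,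
        (∫ o, ‖E.direction j o‖ ^ 2 ∂P + ∫ o, ‖E.direction k o‖ ^ 2 ∂P) +
      (1 / (2 * par.η) * (∫ o, ‖E.virtual k o - xs‖ ^ 2 ∂P -
        ∫ o, ‖E.virtual (k + 1) o - xs‖ ^ 2 ∂P) +
      par.η / 2 * ∫ o, ‖E.direction k o‖ ^ 2 ∂P) := by
  have hdelay : Integrable
      (fun o => inner ℝ (E.direction k o) (E.read k o - E.virtual k o)) P :=
    ((E.isSimpleMap_direction k).comp₂ ((E.isSimpleMap_read k).comp₂ (E.isSimpleMap_virtual k)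
      (· - ·)) (inner ℝ)).integrable
  have hvirtual : Integrable (fun o => inner ℝ (E.direction k o) (E.virtual k o - xs)) P :=
    ((E.isSimpleMap_direction k).comp₂ (E.isSimpleMap_virtual k)
      fun g z => inner ℝ g (z - xs)).integrable
  calc ∫ o, inner ℝ (gradient p.obj (E.point k o)) (E.read k o - xs) ∂P
      = ∫ o, (inner ℝ (E.direction k o) (E.read k o - E.virtual k o) +
          inner ℝ (E.direction k o) (E.virtual k o - xs)) ∂P := by
        simp_rw [← inner_add_right, sub_add_sub_cancel]
        exact (hE.integral_inner_direction h hk xs).symm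
    _ = ∫ o, inner ℝ (E.direction k o) (E.read k o - E.virtual k o) ∂P +
          ∫ o, inner ℝ (E.direction k o) (E.virtual k o - xs) ∂P := integral_add hdelay hvirtual
    _ ≤ _ := add_le_add (hE.integral_inner_read_sub_virtual_le hov h hη.le hk)
        (integral_inner_virtual_sub hη.ne' xs).le

theorem IsUnbiased.integral_obj_point_sub_le (hE : E.IsUnbiased P m)
    (h : p.IsSparseSmoothConvex L) (hL : 0 < L) (hθ : 0 ≤ par.θ) (hφ : 0 ≤ par.φ)
    (hφL : par.φ * L = 1 - par.θ) (hk : k < m) (xs : Vec d) :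
    ∫ o, (p.obj (E.point k o) - p.obj xs) ∂P ≤
      (1 - par.θ) * ∫ o, (p.obj (E.snapshot o) - p.obj xs) ∂P +
      par.θ * ∫ o, inner ℝ (gradient p.obj (E.point k o)) (E.read k o - xs) ∂P -
      par.φ / 2 * ∫ o, ‖E.direction k o‖ ^ 2 ∂P := by
  have hsnapshot : Integrable
      (fun o => (1 - par.θ) * (p.obj (E.snapshot o) - p.obj xs)) P :=
    (E.isSimpleMap_snapshot.comp fun x => (1 - par.θ) * (p.obj x - p.obj xs)).integrable
  have hinner : Integrable (fun o => par.θ *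
      inner ℝ (gradient p.obj (E.point k o)) (E.read k o - xs)) P :=
    ((E.isSimpleMap_point k).comp₂ (E.isSimpleMap_read k)
      fun y z => par.θ * inner ℝ (gradient p.obj y) (z - xs)).integrable
  have hmoment : Integrable (fun o => par.φ / 2 *
      (1 / (n : ℝ) * ∑ a, ‖p.estimator (E.snapshot o) a (E.point k o)‖ ^ 2)) P :=
    (E.isSimpleMap_snapshot.comp₂ (E.isSimpleMap_point k) fun x y =>
      par.φ / 2 * (1 / (n : ℝ) * ∑ a, ‖p.estimator x a y‖ ^ 2)).integrable
  rw [hE.integral_norm_direction_sq hk, ← integral_const_mul, ← integral_const_mul,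
    ← integral_const_mul]
  refine (integral_mono ((E.isSimpleMap_point k).comp fun y => p.obj y - p.obj xs).integrable
    ((hsnapshot.add hinner).sub hmoment) fun o =>
      h.obj_couple_sub_le hL hθ hφ hφL _ _ _).trans_eq ?_
  exact (integral_sub (hsnapshot.add hinner) hmoment).trans
    (congrArg (· - _) (integral_add hsnapshot hinner))

end Expectation

end RandomEpoch

namespace Params

/-- The conditions on `ϑ`, `φ`, `η` under which an epoch makes progress for the smoothness constant
`L`, when asynchrony inflates the second moment of the updates by the factor `a`. -/
structure IsStable (par : Params) (L a : ℝ) : Prop where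
  θ_pos : 0 < par.θ
  θ_le_one : par.θ ≤ 1
  η_pos : 0 < par.η
  φ_mul : par.φ * L = 1 - par.θ
  mul_le : par.θ * par.η * a ≤ par.φ

theorem IsStable.φ_nonneg {par : Params} {L a : ℝ} (hpar : par.IsStable L a) (hL : 0 < L) :
    0 ≤ par.φ :=
  nonneg_of_mul_nonneg_left (hpar.φ_mul ▸ sub_nonneg.2 hpar.θ_le_one) hL

end Params

namespace RandomEpoch

variable {Ω : Type*} [MeasurableSpace Ω] {n d : ℕ} {p : Problem n d} {par : Params}
  {E : RandomEpoch Ω p par} {P : Measure Ω} [IsProbabilityMeasure P] {m τ : ℕ} {L : ℝ}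

theorem IsUnbiased.sum_integral_inner_gradient_le (hE : E.IsUnbiased P m)
    (hov : E.HasOverlapLE m τ) (h : p.IsSparseSmoothConvex L) (hη : 0 < par.η) (xs : Vec d) :
    ∑ k ∈ Finset.range m,
        ∫ o, inner ℝ (gradient p.obj (E.point k o)) (E.read k o - xs) ∂P ≤
      1 / (2 * par.η) *
        (∫ o, ‖E.memory o - xs‖ ^ 2 ∂P - ∫ o, ‖E.virtual m o - xs‖ ^ 2 ∂P) +
      par.η / 2 * (1 + 2 * √p.density * τ) *
        ∑ k ∈ Finset.range m, ∫ o, ‖E.direction k o‖ ^ 2 ∂P := by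
  have hsum := Finset.sum_le_sum fun k hk =>
    hE.integral_inner_gradient_le hov h hη (Finset.mem_range.1 hk) xs
  have htelescope := Finset.sum_range_sub' (fun k => ∫ o, ‖E.virtual k o - xs‖ ^ 2 ∂P) m
  have hoverlap := mul_le_mul_of_nonneg_left
    (sum_overlap_le (a := fun k => ∫ o, ‖E.direction k o‖ ^ 2 ∂P)
      (fun k => integral_nonneg fun o => sq_nonneg _) m τ)
    (by positivity : 0 ≤ par.η * (√p.density / 2))
  rw [Finset.sum_add_distrib, Finset.sum_add_distrib, ← Finset.mul_sum, ← Finset.mul_sum,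
    ← Finset.mul_sum, htelescope] at hsum
  change _ ≤ 1 / (2 * par.η) *
    (∫ o, ‖E.virtual 0 o - xs‖ ^ 2 ∂P - ∫ o, ‖E.virtual m o - xs‖ ^ 2 ∂P) + _
  linarith

theorem IsUnbiased.mean_obj_point_sub_le (hE : E.IsUnbiased P m) (hov : E.HasOverlapLE m τ)
    (h : p.IsSparseSmoothConvex L) (hL : 0 < L)
    (hpar : par.IsStable L (1 + 2 * √p.density * τ)) (hm : 0 < m) (xs : Vec d) :
    1 / (m : ℝ) * ∑ k ∈ Finset.range m, ∫ o, (p.obj (E.point k o) - p.obj xs) ∂P ≤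
      (1 - par.θ) * ∫ o, (p.obj (E.snapshot o) - p.obj xs) ∂P +
      par.θ / (2 * par.η * m) *
        (∫ o, ‖E.memory o - xs‖ ^ 2 ∂P - ∫ o, ‖E.virtual m o - xs‖ ^ 2 ∂P) := by
  have hη := hpar.η_pos
  have hm' : (0 : ℝ) < m := Nat.cast_pos.2 hm
  have hsum := Finset.sum_le_sum fun k hk => hE.integral_obj_point_sub_le h hL hpar.θ_pos.le
    (hpar.φ_nonneg hL) hpar.φ_mul (Finset.mem_range.1 hk) xs
  rw [Finset.sum_sub_distrib, Finset.sum_add_distrib, Finset.sum_const, Finset.card_range,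
    nsmul_eq_mul, ← Finset.mul_sum, ← Finset.mul_sum] at hsum
  have hinner := mul_le_mul_of_nonneg_left
    (hE.sum_integral_inner_gradient_le hov h hη xs) hpar.θ_pos.le
  have habsorb : par.θ * par.η * (1 + 2 * √p.density * τ) *
      ∑ k ∈ Finset.range m, ∫ o, ‖E.direction k o‖ ^ 2 ∂P ≤
      par.φ * ∑ k ∈ Finset.range m, ∫ o, ‖E.direction k o‖ ^ 2 ∂P :=
    mul_le_mul_of_nonneg_right hpar.mul_le
      (Finset.sum_nonneg fun k _ => integral_nonneg fun o => sq_nonneg _)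
  rw [one_div_mul_eq_div, div_le_iff₀' hm']
  calc _ ≤ m * ((1 - par.θ) * ∫ o, (p.obj (E.snapshot o) - p.obj xs) ∂P) +
        par.θ * (1 / (2 * par.η) *
          (∫ o, ‖E.memory o - xs‖ ^ 2 ∂P - ∫ o, ‖E.virtual m o - xs‖ ^ 2 ∂P)) := by linarith
    _ = _ := by field_simp

end RandomEpoch

/-! ### Executions -/

namespace Execution

variable {Ω : Type*} [MeasurableSpace Ω] {n d m : ℕ} (e : Execution Ω n d m) (p : Problem n d)
  (par : Params) (x₀ : Vec d)

theorem isSimpleMap_epochs (r : ℕ) {q : Ω → Vec d × ℕ} (hq : IsSimpleMap fun o => (q o).1)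
    (s : ℕ) : IsSimpleMap (fun o => (e.epochs p par o r (q o).1 (q o).2 s).snapshot) ∧
      IsSimpleMap fun o => (e.epochs p par o r (q o).1 (q o).2 s).memory := by
  induction s with
  | zero => exact ⟨hq, hq⟩
  | succ s ih =>
    let E : RandomEpoch Ω p par := ⟨_, _, e.sample r s, e.written r s, ih.1, ih.2,
      e.measurable_sample r s, e.measurable_written r s⟩
    exact ⟨(IsSimpleMap.pi fun k : Fin m => E.isSimpleMap_point k).comp₂
      (.of_measurable (e.measurable_pick r s)) fun f t => f t, E.isSimpleMap_virtual m⟩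

theorem isSimpleMap_output (r : ℕ) : IsSimpleMap (e.output p par x₀ r) := by
  induction r with
  | zero => exact .const x₀
  | succ r ih =>
    exact (IsSimpleMap.sum (Finset.range par.S) fun s =>
      (e.isSimpleMap_epochs p par r ih (s + 1)).1).comp fun x => (1 / (par.S : ℝ)) • x

theorem integrable_obj_output {P : Measure Ω} [IsFiniteMeasure P] (r : ℕ) :
    Integrable (fun o => p.obj (e.output p par x₀ r o)) P :=
  ((e.isSimpleMap_output p par x₀ r).comp p.obj).integrable

/-- Epoch `s` of round `r` of an execution. -/
def epoch (r s : ℕ) : RandomEpoch Ω p par where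
  snapshot o := (e.stateAt p par x₀ r s o).snapshot
  memory o := (e.stateAt p par x₀ r s o).memory
  sample := e.sample r s
  written := e.written r s
  isSimpleMap_snapshot := (e.isSimpleMap_epochs p par r (e.isSimpleMap_output p par x₀ r) s).1
  isSimpleMap_memory := (e.isSimpleMap_epochs p par r (e.isSimpleMap_output p par x₀ r) s).2
  measurable_sample := e.measurable_sample r s
  measurable_written := e.measurable_written r s

variable {e p par x₀} {P : Measure Ω} {R τ : ℕ} {L : ℝ} {r s : ℕ}

theorem Unbiased.isUnbiased_epoch (hu : e.Unbiased P p par x₀ R) (hr : r < R)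
    (hs : s < par.S) : (e.epoch p par x₀ r s).IsUnbiased P m :=
  ⟨hu.sample_uniform r hr s hs, hu.sample_indep r hr s hs⟩

theorem BoundedOverlap.hasOverlapLE_epoch (hb : e.BoundedOverlap par R τ) (hr : r < R)
    (hs : s < par.S) : (e.epoch p par x₀ r s).HasOverlapLE m τ :=
  hb r hr s hs

variable [IsProbabilityMeasure P]

theorem Unbiased.integral_snapshot_succ (hu : e.Unbiased P p par x₀ R) (hr : r < R)
    (hs : s < par.S) (ψ : Vec d → ℝ) :
    ∫ o, ψ ((e.epoch p par x₀ r (s + 1)).snapshot o) ∂P =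
      1 / (m : ℝ) * ∑ k ∈ Finset.range m, ∫ o, ψ ((e.epoch p par x₀ r s).point k o) ∂P := by
  set E := e.epoch p par x₀ r s
  rw [← integral_finsetSum _ fun k _ => ((E.isSimpleMap_point k).comp ψ).integrable,
    ← integral_const_mul]
  refine (IsSimpleMap.integral_of_uniform (e.measurable_pick r s) (E.isSimpleMap_past m)
    (hu.pick_indep r hr s hs) (hu.pick_uniform r hr s hs)
    fun t b => ψ (couple p par b.1 (b.2 t).2)).trans (integral_congr_ae (.of_forall fun o => ?_))
  exact congrArg (1 / (m : ℝ) * ·)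
    (Fin.sum_univ_eq_sum_range (fun k => ψ (E.point k o)) m)

theorem integral_obj_snapshot_succ_sub_le (h : p.IsSparseSmoothConvex L) (hL : 0 < L)
    (hpar : par.IsStable L (1 + 2 * √p.density * τ)) (hm : 0 < m)
    (hu : e.Unbiased P p par x₀ R) (hb : e.BoundedOverlap par R τ) (hr : r < R) (hs : s < par.S)
    (xs : Vec d) :
    ∫ o, (p.obj ((e.epoch p par x₀ r (s + 1)).snapshot o) - p.obj xs) ∂P ≤
      (1 - par.θ) * ∫ o, (p.obj ((e.epoch p par x₀ r s).snapshot o) - p.obj xs) ∂P +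
      par.θ / (2 * par.η * m) * (∫ o, ‖(e.epoch p par x₀ r s).memory o - xs‖ ^ 2 ∂P -
        ∫ o, ‖(e.epoch p par x₀ r (s + 1)).memory o - xs‖ ^ 2 ∂P) :=
  (hu.integral_snapshot_succ hr hs fun x => p.obj x - p.obj xs).trans_le <|
    (hu.isUnbiased_epoch hr hs).mean_obj_point_sub_le (hb.hasOverlapLE_epoch hr hs) h hL hpar hm xs

theorem calls_epochs (o : Ω) (r : ℕ) (x : Vec d) (c s : ℕ) :
    (e.epochs p par o r x c s).calls = c + s * (n + 2 * m) := by
  induction s with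
  | zero => simp [epochs]
  | succ s ih =>
    simp only [epochs, ih]
    ring

theorem oracleCalls_eq (o : Ω) (R : ℕ) :
    e.oracleCalls p par x₀ R o = R * (par.S * (n + 2 * m)) := by
  induction R with
  | zero => simp [oracleCalls, rounds]
  | succ R ih =>
    rw [oracleCalls] at ih ⊢
    simp only [rounds, calls_epochs, ih]
    ring

end Execution

/-! ### The contraction of a round -/

theorem sum_le_of_potential_decrease {θ c : ℝ} {F Z : ℕ → ℝ} {S : ℕ}
    (hstep : ∀ s < S, F (s + 1) ≤ (1 - θ) * F s + c * (Z s - Z (s + 1))) :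
    θ * ∑ s ∈ Finset.range S, F (s + 1) + (1 - θ) * F S + c * Z S ≤
      (1 - θ) * F 0 + c * Z 0 := by
  induction S with
  | zero => simp
  | succ S ih =>
    rw [Finset.sum_range_succ]
    linarith [ih fun s hs => hstep s (by omega), hstep S (by omega)]

theorem mean_le_mul_of_potential_decrease {θ c ν q : ℝ} {F Z : ℕ → ℝ} {S : ℕ} (hθ : 0 < θ)
    (hθ1 : θ ≤ 1) (hc : 0 ≤ c) (hS : 0 < S) (hF : ∀ s, 0 ≤ F s) (hZ : ∀ s, 0 ≤ Z s)
    (hZF : Z 0 ≤ ν * F 0) (hq : 1 - θ + c * ν ≤ q * (θ * S))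
    (hstep : ∀ s < S, F (s + 1) ≤ (1 - θ) * F s + c * (Z s - Z (s + 1))) :
    1 / (S : ℝ) * ∑ s ∈ Finset.range S, F (s + 1) ≤ q * F 0 := by
  have hS' : (0 : ℝ) < S := Nat.cast_pos.2 hS
  rw [one_div_mul_eq_div, div_le_iff₀ hS']
  refine le_of_mul_le_mul_left ?_ hθ
  calc θ * ∑ s ∈ Finset.range S, F (s + 1)
      ≤ (1 - θ) * F 0 + c * Z 0 := by
        linarith [sum_le_of_potential_decrease hstep, mul_nonneg hc (hZ S),
          mul_nonneg (sub_nonneg.2 hθ1) (hF S)]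
    _ ≤ (1 - θ) * F 0 + c * (ν * F 0) := by gcongr
    _ = (1 - θ + c * ν) * F 0 := by ring
    _ ≤ q * (θ * S) * F 0 := mul_le_mul_of_nonneg_right hq (hF 0)
    _ = θ * (q * F 0 * S) := by ring

namespace Problem.QuadraticGrowth

variable {n d : ℕ} {p : Problem n d} {μ : ℝ} {xs : Vec d}

theorem obj_sub_nonneg (hq : p.QuadraticGrowth μ xs) (hμ : 0 ≤ μ) (x : Vec d) :
    0 ≤ p.obj x - p.obj xs :=
  le_trans (by positivity) (hq x)

theorem norm_sub_sq_le (hq : p.QuadraticGrowth μ xs) (hμ : 0 < μ) (x : Vec d) :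
    ‖x - xs‖ ^ 2 ≤ 2 / μ * (p.obj x - p.obj xs) := by
  refine le_of_mul_le_mul_left ((hq x).trans_eq ?_) (half_pos hμ)
  field_simp

end Problem.QuadraticGrowth

namespace Execution

variable {Ω : Type*} [MeasurableSpace Ω] {n d m : ℕ} {e : Execution Ω n d m} {p : Problem n d}
  {par : Params} {x₀ xs : Vec d} {P : Measure Ω} [IsProbabilityMeasure P] {R τ : ℕ}
  {L μ q : ℝ}

theorem obj_output_succ_sub_le (h : p.IsSparseSmoothConvex L) (hS : 0 < par.S) (r : ℕ) (o : Ω) :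
    p.obj (e.output p par x₀ (r + 1) o) - p.obj xs ≤ 1 / (par.S : ℝ) *
      ∑ s ∈ Finset.range par.S,
        (p.obj ((e.epoch p par x₀ r (s + 1)).snapshot o) - p.obj xs) := by
  have hS' : (par.S : ℝ) ≠ 0 := Nat.cast_ne_zero.2 hS.ne'
  have hjensen := h.convexOn_obj.map_sum_le (t := Finset.range par.S)
    (w := fun _ => 1 / (par.S : ℝ)) (p := fun s => (e.epoch p par x₀ r (s + 1)).snapshot o)
    (fun _ _ => by positivity) (by simp [hS']) fun _ _ => Set.mem_univ _
  rw [← Finset.smul_sum, ← Finset.smul_sum] at hjensen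
  rw [Finset.sum_sub_distrib, Finset.sum_const, Finset.card_range, nsmul_eq_mul, mul_sub,
    one_div_mul_eq_div _ (_ * _), mul_div_cancel_left₀ _ hS']
  exact sub_le_sub_right hjensen _

theorem integral_obj_output_succ_sub_le (h : p.IsSparseSmoothConvex L)
    (hgrowth : p.QuadraticGrowth μ xs) (hL : 0 < L) (hμ : 0 < μ)
    (hpar : par.IsStable L (1 + 2 * √p.density * τ)) (hm : 0 < m) (hS : 0 < par.S)
    (hq : 1 - par.θ + par.θ / (2 * par.η * m) * (2 / μ) ≤ q * (par.θ * par.S))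
    (hu : e.Unbiased P p par x₀ R) (hb : e.BoundedOverlap par R τ) {r : ℕ} (hr : r < R) :
    ∫ o, (p.obj (e.output p par x₀ (r + 1) o) - p.obj xs) ∂P ≤
      q * ∫ o, (p.obj (e.output p par x₀ r o) - p.obj xs) ∂P := by
  have hη := hpar.η_pos
  have hθ := hpar.θ_pos
  let E := e.epoch p par x₀ r
  have hgap : ∀ s, Integrable (fun o => p.obj ((E s).snapshot o) - p.obj xs) P := fun s =>
    ((E s).isSimpleMap_snapshot.comp fun x => p.obj x - p.obj xs).integrable
  have hstart : ∫ o, ‖(E 0).memory o - xs‖ ^ 2 ∂P ≤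
      2 / μ * ∫ o, (p.obj ((E 0).snapshot o) - p.obj xs) ∂P := by
    rw [← integral_const_mul]
    exact integral_mono ((E 0).isSimpleMap_memory.comp fun z => ‖z - xs‖ ^ 2).integrable
      ((hgap 0).const_mul _) fun o => hgrowth.norm_sub_sq_le hμ _
  calc ∫ o, (p.obj (e.output p par x₀ (r + 1) o) - p.obj xs) ∂P
      ≤ ∫ o, 1 / (par.S : ℝ) * ∑ s ∈ Finset.range par.S,
          (p.obj ((E (s + 1)).snapshot o) - p.obj xs) ∂P :=
        integral_mono ((e.integrable_obj_output p par x₀ (r + 1)).sub (integrable_const _))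
          ((integrable_finsetSum _ fun s _ => hgap (s + 1)).const_mul _)
          (obj_output_succ_sub_le h hS r)
    _ = 1 / (par.S : ℝ) * ∑ s ∈ Finset.range par.S,
          ∫ o, (p.obj ((E (s + 1)).snapshot o) - p.obj xs) ∂P := by
        rw [integral_const_mul, integral_finsetSum _ fun s _ => hgap (s + 1)]
    _ ≤ q * ∫ o, (p.obj ((E 0).snapshot o) - p.obj xs) ∂P :=
        mean_le_mul_of_potential_decrease
          (F := fun s => ∫ o, (p.obj ((E s).snapshot o) - p.obj xs) ∂P)
          (Z := fun s => ∫ o, ‖(E s).memory o - xs‖ ^ 2 ∂P) hθ hpar.θ_le_one (by positivity) hS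
          (fun s => integral_nonneg fun o => hgrowth.obj_sub_nonneg hμ.le _)
          (fun s => integral_nonneg fun o => sq_nonneg _) hstart hq fun s hs =>
          integral_obj_snapshot_succ_sub_le h hL hpar hm hu hb hr hs xs

theorem integral_obj_output_sub_le (h : p.IsSparseSmoothConvex L)
    (hgrowth : p.QuadraticGrowth μ xs) (hL : 0 < L) (hμ : 0 < μ)
    (hpar : par.IsStable L (1 + 2 * √p.density * τ)) (hm : 0 < m) (hS : 0 < par.S)
    (hq0 : 0 ≤ q) (hq : 1 - par.θ + par.θ / (2 * par.η * m) * (2 / μ) ≤ q * (par.θ * par.S))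
    (hu : e.Unbiased P p par x₀ R) (hb : e.BoundedOverlap par R τ) {r : ℕ} (hr : r ≤ R) :
    ∫ o, p.obj (e.output p par x₀ r o) ∂P - p.obj xs ≤ q ^ r * (p.obj x₀ - p.obj xs) := by
  induction r with
  | zero => simp [output, rounds]
  | succ r ih =>
    have hgap : ∀ r, ∫ o, (p.obj (e.output p par x₀ r o) - p.obj xs) ∂P =
        ∫ o, p.obj (e.output p par x₀ r o) ∂P - p.obj xs := by
      intro r
      rw [integral_sub (e.integrable_obj_output p par x₀ r) (integrable_const _), integral_const,
        probReal_univ, one_smul]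
    have hround := integral_obj_output_succ_sub_le h hgrowth hL hμ hpar hm hS hq hu hb hr
    rw [hgap, hgap] at hround
    calc _ ≤ q * (∫ o, p.obj (e.output p par x₀ r o) ∂P - p.obj xs) := hround
      _ ≤ q * (q ^ r * (p.obj x₀ - p.obj xs)) := by
        gcongr
        exact ih (by omega)
      _ = _ := by ring

end Execution

/-! ### The choice of the parameters -/

namespace Params

variable {L μ κ a b ω : ℝ} {m n : ℕ}

theorem choice_θ_pos (hm : 0 < m) : 0 < (choice L κ a ω m).θ := by
  simp only [choice]
  positivity

theorem choice_θ_mul_sqrt (hm : 0 < m) :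
    (choice L κ a ω m).θ * √(κ * a) = (1 - (choice L κ a ω m).θ) * √m := by
  simp only [choice]
  field_simp
  ring

theorem choice_θ_lt_one (hm : 0 < m) (hκ : 0 < κ) (ha : 0 < a) :
    (choice L κ a ω m).θ < 1 := by
  have : 0 < √(κ * a) := by positivity
  simp only [choice]
  rw [div_lt_one (by positivity)]
  exact lt_add_of_pos_left _ this

theorem choice_θ_mul_η_mul (hm : 0 < m) (ha : a ≠ 0) :
    (choice L κ a ω m).θ * (choice L κ a ω m).η * a = (choice L κ a ω m).φ := by
  have hθ := (choice_θ_pos (L := L) (κ := κ) (a := a) (ω := ω) hm).ne'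
  change _ * ((1 - (choice L κ a ω m).θ) / (L * (choice L κ a ω m).θ * a)) * a =
    (1 - (choice L κ a ω m).θ) / L
  field_simp

theorem choice_η_pos (hm : 0 < m) (hL : 0 < L) (hκ : 0 < κ) (ha : 0 < a) :
    0 < (choice L κ a ω m).η :=
  div_pos (sub_pos.2 (choice_θ_lt_one (L := L) (ω := ω) hm hκ ha))
    (mul_pos (mul_pos hL (choice_θ_pos (L := L) (ω := ω) hm)) ha)

theorem isStable_choice (hm : 0 < m) (hL : 0 < L) (hκ : 0 < κ) (ha : 0 < a) (hb : b ≤ a) :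
    (choice L κ a ω m).IsStable L b where
  θ_pos := choice_θ_pos hm
  θ_le_one := (choice_θ_lt_one hm hκ ha).le
  η_pos := choice_η_pos hm hL hκ ha
  φ_mul := div_mul_cancel₀ _ hL.ne'
  mul_le := by
    rw [← choice_θ_mul_η_mul hm ha.ne']
    exact mul_le_mul_of_nonneg_left hb
      (mul_pos (choice_θ_pos hm) (choice_η_pos hm hL hκ ha)).le

theorem choice_S_pos (hω : 0 < ω) (hm : 0 < m) (hκ : 0 < κ) (ha : 0 < a) :
    0 < (choice L κ a ω m).S :=
  Nat.ceil_pos.2 (by positivity)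

theorem two_mul_one_sub_choice_θ_le (hm : 0 < m) (hκ : 0 ≤ κ * a) :
    2 * ω * (1 - (choice L κ a ω m).θ) ≤ (choice L κ a ω m).θ * (choice L κ a ω m).S := by
  have hsqrt : (choice L κ a ω m).θ * √(κ / m * a) = 1 - (choice L κ a ω m).θ := by
    rw [div_mul_eq_mul_div, Real.sqrt_div hκ, mul_div_assoc', choice_θ_mul_sqrt hm]
    field_simp
  calc 2 * ω * (1 - (choice L κ a ω m).θ)
      = (choice L κ a ω m).θ * (2 * ω * √(κ / m * a)) := by
        rw [← hsqrt]
        ring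
    _ ≤ _ := mul_le_mul_of_nonneg_left (Nat.le_ceil _) (choice_θ_pos hm).le

theorem choice_initial_distance_coeff (hm : 0 < m) (hL : 0 < L) (hμ : 0 < μ) (ha : 0 < a) :
    let par := choice L (L / μ) a ω m
    par.θ / (2 * par.η * m) * (2 / μ) = 1 - par.θ := by
  intro par
  have hθ : 0 < par.θ := choice_θ_pos hm
  have hθ1 : 0 < 1 - par.θ := sub_pos.2 (choice_θ_lt_one hm (by positivity) ha)
  have hη : par.η = (1 - par.θ) / (L * par.θ * a) := rfl
  have hsq : par.θ ^ 2 * (L / μ * a) = (1 - par.θ) ^ 2 * m := by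
    have := congrArg (· ^ 2) (choice_θ_mul_sqrt (L := L) (κ := L / μ) (a := a) (ω := ω) hm)
    simpa only [mul_pow, Real.sq_sqrt (by positivity : 0 ≤ L / μ * a),
      Real.sq_sqrt (Nat.cast_nonneg m)] using this
  calc par.θ / (2 * par.η * m) * (2 / μ)
      = par.θ ^ 2 * (L / μ * a) / ((1 - par.θ) * m) := by
        rw [hη]
        field_simp
    _ = 1 - par.θ := by
        rw [hsq]
        field_simp

theorem choice_contraction (hω : 0 < ω) (hm : 0 < m) (hL : 0 < L) (hμ : 0 < μ) (ha : 0 < a) :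
    let par := choice L (L / μ) a ω m
    1 - par.θ + par.θ / (2 * par.η * m) * (2 / μ) ≤ 1 / ω * (par.θ * par.S) := by
  intro par
  rw [choice_initial_distance_coeff hm hL hμ ha, one_div, le_inv_mul_iff₀ hω]
  linarith [two_mul_one_sub_choice_θ_le (L := L) (κ := L / μ) (a := a) (ω := ω) hm
    (by positivity)]

theorem choice_S_mul_le {c : ℝ} (hω : 0 ≤ ω) (hc : 0 < c) (hn : 0 < n) (hm : c * n ≤ m)
    (hκ : 0 ≤ κ) (ha : 0 ≤ a) :
    ((choice L κ a ω m).S : ℝ) * n ≤ (2 * ω / √c + 1) * max (n : ℝ) (√(κ * n * a)) := by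
  have hsqrt : √(κ / m * a) ≤ √(κ * n * a) / (√c * n) := by
    rw [← Real.sqrt_sq (Nat.cast_nonneg n), ← Real.sqrt_mul hc.le,
      Real.sqrt_sq (Nat.cast_nonneg n), ← Real.sqrt_div (by positivity)]
    refine Real.sqrt_le_sqrt ?_
    calc κ / m * a ≤ κ / (c * n) * a := by gcongr
      _ = κ * n * a / (c * n ^ 2) := by field_simp
  calc ((choice L κ a ω m).S : ℝ) * n
      ≤ (2 * ω * √(κ / m * a) + 1) * n := by
        gcongr
        exact (Nat.ceil_lt_add_one (by positivity)).le
    _ ≤ (2 * ω * (√(κ * n * a) / (√c * n)) + 1) * n := by gcongr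
    _ = 2 * ω / √c * √(κ * n * a) + n := by field_simp
    _ ≤ 2 * ω / √c * max (n : ℝ) (√(κ * n * a)) + max (n : ℝ) (√(κ * n * a)) := by
        gcongr
        · exact le_max_right _ _
        · exact le_max_left _ _
    _ = _ := by ring

theorem exists_choice_calls_le {c₁ : ℝ} (c₂ : ℝ) (hω : 0 ≤ ω) (hc₁ : 0 < c₁) :
    ∃ B : ℝ, 1 ≤ B ∧ ∀ (n m : ℕ) (L κ a : ℝ), 0 < n → c₁ * n ≤ m → (m : ℝ) ≤ c₂ * n → 0 ≤ κ →
      0 ≤ a → ((choice L κ a ω m).S : ℝ) * (n + 2 * m) ≤ B * max (n : ℝ) (√(κ * n * a)) := by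
  refine ⟨(1 + 2 * |c₂|) * (2 * ω / √c₁ + 1), ?_, fun n m L κ a hn hm₁ hm₂ hκ ha => ?_⟩
  · exact one_le_mul_of_one_le_of_one_le (le_add_of_nonneg_right (by positivity))
      (le_add_of_nonneg_left (by positivity))
  calc ((choice L κ a ω m).S : ℝ) * (n + 2 * m)
      ≤ (choice L κ a ω m).S * (n + 2 * (|c₂| * n)) := by
        gcongr
        exact hm₂.trans (by gcongr; exact le_abs_self c₂)
    _ = (1 + 2 * |c₂|) * ((choice L κ a ω m).S * n) := by ring
    _ ≤ (1 + 2 * |c₂|) * ((2 * ω / √c₁ + 1) * max (n : ℝ) (√(κ * n * a))) :=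
        mul_le_mul_of_nonneg_left (choice_S_mul_le hω hc₁ hn hm₁ hκ ha) (by positivity)
    _ = _ := by ring

end Params

theorem one_div_pow_mul_le_of_log_le {ω δ ε : ℝ} (hω : 1 < ω) (hε : 0 < ε) {R : ℕ}
    (hR : Real.log (δ / ε) / Real.log ω ≤ R) : (1 / ω) ^ R * δ ≤ ε := by
  have : 0 < ω := one_pos.trans hω
  rw [one_div, inv_pow, inv_mul_le_iff₀ (by positivity), ← div_le_iff₀ hε]
  rcases le_or_gt (δ / ε) 0 with hδ | hδ
  · exact hδ.trans (by positivity)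
  · rwa [← Real.log_le_log_iff hδ (by positivity), Real.log_pow,
      ← div_le_iff₀ (Real.log_pos hω)]

theorem exists_one_div_pow_mul_le {ω : ℝ} (hω : 1 < ω) :
    ∃ A : ℝ, 0 < A ∧ ∀ δ ε : ℝ, 0 < ε → ∃ R : ℕ,
      (R : ℝ) ≤ A * max 1 (Real.log (δ / ε)) ∧ (1 / ω) ^ R * δ ≤ ε := by
  have hlog : 0 < Real.log ω := Real.log_pos hω
  refine ⟨1 / Real.log ω + 1, by positivity, fun δ ε hε =>
    ⟨⌈Real.log (δ / ε) / Real.log ω⌉₊, ?_, one_div_pow_mul_le_of_log_le hω hε (Nat.le_ceil _)⟩⟩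
  set l := Real.log (δ / ε)
  calc (⌈l / Real.log ω⌉₊ : ℝ) ≤ ⌈max 1 l / Real.log ω⌉₊ := by
        gcongr
        exact le_max_right _ _
    _ ≤ max 1 l / Real.log ω + 1 := (Nat.ceil_lt_add_one (by positivity)).le
    _ ≤ max 1 l / Real.log ω + max 1 l := by
        gcongr
        exact le_max_left _ _
    _ = _ := by ring

end AsyncSVRG

end

theorem theorem2 (ω c₁ c₂ : ℝ) (hω : 1 < ω) (hc₁ : 0 < c₁) :
    ∃ C : ℝ, 0 < C ∧
      ∀ (n d m τ : ℕ) (τt L μ : ℝ) (p : AsyncSVRG.Problem n d) (x₀ xs : AsyncSVRG.Vec d) (ε : ℝ),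
        0 < n → c₁ * n ≤ m → (m : ℝ) ≤ c₂ * n → (τ : ℝ) ≤ τt → 0 < L → 0 < μ → 0 < ε →
        p.IsSparseSmoothConvex L → p.QuadraticGrowth μ xs →
        ∃ R : ℕ,
          (R : ℝ) ≤ C * max 1 (Real.log ((p.obj x₀ - p.obj xs) / ε)) ∧
          ∀ (Ω : Type*) [MeasurableSpace Ω] (P : Measure Ω) [IsProbabilityMeasure P]
            (e : AsyncSVRG.Execution Ω n d m) (par : AsyncSVRG.Params),
            par = AsyncSVRG.Params.choice L (L / μ) (1 + 2 * √p.density * τt) ω m →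
            e.Unbiased P p par x₀ R → e.BoundedOverlap par R τ →
            Integrable (fun o => p.obj (e.output p par x₀ R o)) P ∧
            (∫ o, p.obj (e.output p par x₀ R o) ∂P) - p.obj xs ≤ ε ∧
            ∀ o, (e.oracleCalls p par x₀ R o : ℝ) ≤
              C * max (n : ℝ) (√(L / μ * n * (1 + 2 * √p.density * τt))) *
                max 1 (Real.log ((p.obj x₀ - p.obj xs) / ε)) := by
  have hω0 : 0 < ω := one_pos.trans hω
  obtain ⟨A, hA, hrounds⟩ := AsyncSVRG.exists_one_div_pow_mul_le hω
  obtain ⟨B, hB, hcalls⟩ := AsyncSVRG.Params.exists_choice_calls_le c₂ hω0.le hc₁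
  refine ⟨A * B, by positivity, ?_⟩
  intro n d m τ τt L μ p x₀ xs ε hn hm₁ hm₂ hτ hL hμ hε h hgrowth
  have hm : 0 < m := Nat.cast_pos.1 ((by positivity : 0 < c₁ * n).trans_le hm₁)
  have hτt : 0 ≤ τt := (Nat.cast_nonneg τ).trans hτ
  have hκ : 0 < L / μ := div_pos hL hμ
  obtain ⟨R, hRlog, hRgap⟩ := hrounds (p.obj x₀ - p.obj xs) ε hε
  refine ⟨R, hRlog.trans ?_, ?_⟩
  · gcongr
    exact le_mul_of_one_le_right hA.le hB
  rintro Ω _ P _ e _ rfl hu hb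
  refine ⟨e.integrable_obj_output p _ x₀ R, ?_, fun o => ?_⟩
  · exact (AsyncSVRG.Execution.integral_obj_output_sub_le h hgrowth hL hμ
      (AsyncSVRG.Params.isStable_choice hm hL hκ (by positivity) (by gcongr)) hm
      (AsyncSVRG.Params.choice_S_pos hω0 hm hκ (by positivity)) (by positivity)
      (AsyncSVRG.Params.choice_contraction hω0 hm hL hμ (by positivity)) hu hb le_rfl).trans hRgap
  · rw [AsyncSVRG.Execution.oracleCalls_eq]
    push_cast
    exact (mul_le_mul hRlog (hcalls n m L _ _ hn hm₁ hm₂ hκ.le (by positivity)) (by positivity)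
      (by positivity)).trans_eq (by ring)
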